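/- A translation surface $(X,\omega)$ is a closed connected Riemann surface $X$ with a holomorphic $1$-form $\omega\not\equiv 0$; its natural parameters are the local coordinates $\varphi$ with $d\varphi=\omega$, defined away from the zeroes of $\omega$. Its vertical foliation $\mathcal F_v$ is the foliation $\operatorname{Re}\omega=0$ of the complement of the zeroes; it is ergodic if every Borel set that is a union of leaves has either zero area or a complement of zero area, for the flat area $|\omega|^2$. A saddle connection is a geodesic segment of the flat metric $|\omega|$ that joins two (possibly equal) zeroes of $\omega$ and has no zero in its interior. If $\omega$ has a zero, let $\ell(X)$ be the length of the shortest saddle connection. The Teichmüller geodesic of $(X,\omega)$ is the family $(X_t)_{t\in\mathbb R}$ of translation surfaces obtained from $(X,\omega)$ by post-composing the natural parameters with the $\mathbb R$-linear map $z\mapsto e^{t/2}\operatorname{Re}z+i\,e^{-t/2}\operatorname{Im}z$. Put $d(t)=-2\log\ell(X_t)$. **Theorem.** For every function $r:\mathbb R\to\mathbb R$ with $r(t)\to\infty$ as $t\to\infty$ there is a translation surface $(X,\omega)$, where $\omega$ has at least one zero, whose vertical foliation $\mathcal F_v$ is not ergodic and whose Teichmüller geodesic $X_t$ satisfies $$\liminf_{t\to\infty}\frac{d(t)}{r(t)}<1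 .$$ -/

import Mathlib

open scoped Manifold ContDiff Topology
open Filter MeasureTheory

noncomputable section

/-- A translation surface `(X, ω)`: a closed (compact, connected) Riemann surface `X` together with
a holomorphic `1`-form `ω` (called `form` below) that does not vanish identically.  That `ω` is
holomorphic means that in every chart `z` of the Riemann surface it reads `ω = f(z) dz` with `f`
holomorphic. -/
structure TranslationSurface where
  carrier : Type
  [topology : TopologicalSpace carrier]
  [t2 : T2Space carrier]
  [compact : CompactSpace carrier]
  [connected : ConnectedSpace carrier]
  [charted : ChartedSpace ℂ carrier]
  [manifold : IsManifold 𝓘(ℂ) ω carrier]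
  form : (x : carrier) → TangentSpace 𝓘(ℂ) x →L[ℂ] ℂ
  holomorphic : ∀ x₀ : carrier, DifferentiableOn ℂ
    (fun z : ℂ => form ((chartAt ℂ x₀).symm z)
      (mfderiv 𝓘(ℂ) 𝓘(ℂ) (chartAt ℂ x₀).symm z ((NormedSpace.fromTangentSpace z).symm 1)))
    (chartAt ℂ x₀).target
  form_ne_zero : ∃ x, form x ≠ 0

namespace TranslationSurface

attribute [instance] topology t2 compact connected charted manifold

/-- The zeroes of `ω`. -/
def zeros (X : TranslationSurface) : Set X.carrier := {x | X.form x = 0}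

/-- A natural parameter of `(X, ω)`: a coordinate `φ`, defined on an open set that contains no zero
of `ω`, such that `dφ = ω`. -/
def IsNaturalParameter (X : TranslationSurface) (φ : OpenPartialHomeomorph X.carrier ℂ) : Prop :=
  ∀ x ∈ φ.source, x ∉ X.zeros ∧ MDifferentiableAt 𝓘(ℂ) 𝓘(ℂ) φ x ∧
    ∀ v : TangentSpace 𝓘(ℂ) x,
      NormedSpace.fromTangentSpace (φ x) (mfderiv 𝓘(ℂ) 𝓘(ℂ) φ x v) = X.form x v

/-- The path `γ`, restricted to the set `J` of times, stays away from the zeroes of `ω` and is a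
straight line of constant velocity `v` in natural parameters. -/
def IsStraightOn (X : TranslationSurface) (γ : ℝ → X.carrier) (v : ℂ) (J : Set ℝ) : Prop :=
  ∀ s ∈ J, ∃ φ, X.IsNaturalParameter φ ∧ γ s ∈ φ.source ∧
    ∀ᶠ u in 𝓝[J] s, γ u ∈ φ.source ∧ φ (γ u) = φ (γ s) + ((u - s : ℝ) : ℂ) * v

/-- `γ`, on the time interval `[0, 1]`, is a saddle connection with holonomy `v = ∫_γ ω`: a geodesic
segment of the flat metric `|ω|` from a zero of `ω` to a zero of `ω`, with no zero in its interior.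
Its length is `|v|`. -/
def IsSaddleConnection (X : TranslationSurface) (γ : ℝ → X.carrier) (v : ℂ) : Prop :=
  ContinuousOn γ (Set.Icc 0 1) ∧ γ 0 ∈ X.zeros ∧ γ 1 ∈ X.zeros ∧ X.IsStraightOn γ v (Set.Ioo 0 1)

/-- `ℓ(X)`: the infimum of the lengths of the saddle connections of `X` (in `[0, ∞]`, so that the
value is `∞` exactly if there are none, that is if `ω` has no zero). -/
def shortest (X : TranslationSurface) : ENNReal :=
  ⨅ (γ : ℝ → X.carrier) (v : ℂ) (_ : X.IsSaddleConnection γ v), ENNReal.ofReal ‖v‖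

/-- `-2 log ℓ(X)`, with the conventions `log 0 = -∞` and `log ∞ = ∞`. -/
def logSystole (X : TranslationSurface) : EReal := ((-2 : ℝ) : EReal) * ENNReal.log X.shortest

/-- `x` and `y` lie on the same leaf of the vertical foliation `Re ω = 0` (a foliation of the
complement of the zeroes of `ω`), and `y` is reached from `x` by moving upwards by some `T ≥ 0`. -/
def VerticallyJoined (X : TranslationSurface) (x y : X.carrier) : Prop :=
  ∃ (γ : ℝ → X.carrier) (T : ℝ), 0 ≤ T ∧ γ 0 = x ∧ γ T = y ∧
    X.IsStraightOn γ Complex.I (Set.Icc 0 T)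

/-- `A` is, off the zeroes of `ω`, a union of leaves of the vertical foliation. -/
def IsVerticallySaturated (X : TranslationSurface) (A : Set X.carrier) : Prop :=
  ∀ x y, X.VerticallyJoined x y → (x ∈ A ↔ y ∈ A)

/-- `A` has zero area for the flat metric `|ω|`, that is, zero Lebesgue measure in every natural
parameter (the zeroes of `ω` form a finite set and do not count). -/
def IsNull (X : TranslationSurface) (A : Set X.carrier) : Prop :=
  ∀ φ, X.IsNaturalParameter φ → volume (φ.target ∩ φ.symm ⁻¹' A) = 0

/-- The vertical foliation is ergodic (with respect to Lebesgue measure): every Borel set that is a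
union of leaves has zero area or has a complement of zero area. -/
def IsVerticallyErgodic (X : TranslationSurface) : Prop :=
  ∀ A : Set X.carrier, MeasurableSet[borel X.carrier] A → X.IsVerticallySaturated A →
    X.IsNull A ∨ X.IsNull Aᶜ

end TranslationSurface

/-- The `ℝ`-linear map `z ↦ e^{t/2} Re z + i e^{-t/2} Im z` of `ℂ`. -/
def teichmullerMap (t : ℝ) : ℂ ≃ₜ ℂ where
  toFun z := ⟨Real.exp (t / 2) * z.re, Real.exp (-t / 2) * z.im⟩
  invFun z := ⟨Real.exp (-t / 2) * z.re, Real.exp (t / 2) * z.im⟩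
  left_inv z := by
    apply Complex.ext <;> simp only [← mul_assoc, ← Real.exp_add] <;> ring_nf <;> simp
  right_inv z := by
    apply Complex.ext <;> simp only [← mul_assoc, ← Real.exp_add] <;> ring_nf <;> simp
  continuous_toFun := by
    simp only [Complex.mk_eq_add_mul_I]
    fun_prop
  continuous_invFun := by
    simp only [Complex.mk_eq_add_mul_I]
    fun_prop

/-- `Y` is the evolution of `X` under the Teichmüller flow for the time `t`: for some homeomorphism
`f : X → Y` (the Teichmüller map), the natural parameters of `Y` are the ones of `X`, transported by
`f` and post-composed with `z ↦ e^{t/2} Re z + i e^{-t/2} Im z`. -/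
def TranslationSurface.IsEvolution (X : TranslationSurface) (t : ℝ) (Y : TranslationSurface) :
    Prop :=
  ∃ f : X.carrier ≃ₜ Y.carrier, ∀ φ : OpenPartialHomeomorph X.carrier ℂ,
    X.IsNaturalParameter φ ↔
      Y.IsNaturalParameter ((f.symm.toOpenPartialHomeomorph.trans φ).trans
        (teichmullerMap t).toOpenPartialHomeomorph)

/-- `t ↦ X t` is the Teichmüller geodesic through the translation surface `X 0`. -/
def IsTeichmullerGeodesic (X : ℝ → TranslationSurface) : Prop :=
  ∀ t : ℝ, (X 0).IsEvolution t (X t)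

end

/-!
The surface is a double cover of the torus `ℂ / ℤ[i]`, slit along the segment `[-a, a]` of the
real axis and glued crosswise, where `α = 2a` is irrational; `ω` is the lift of `dz`. It is
realised as the curve `Y² = F` over the torus, for a function `F` whose values are negative real
numbers exactly on the open slit: the two sheets are `Re Y > 0` and `Re Y < 0`, and they are
exchanged exactly by crossing the slit. `F` vanishes only at the two ends of the slit, which give
the two zeroes of `ω`. For a suitable slope `θ` the direction `(θ, 1)` is made vertical by a
shear. Since the vertical flow, the saddle connections and the Teichmüller flow depend only on
local coordinates, all of them are read off on the torus.

**The slope.** The holonomy `w₀ = (α, 0)` of the slit is modified step by step: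
`w_{j+1} = w_j + 2v_j` with coprime integer vectors `v_j = (k_j, l_j)`. As `α` is irrational,
`v_j` can be chosen with `l_j` as large as one likes and with `|w_j × v_j|` between `4^{-j} / 2`
and `4^{-j}` (`exists_coprime_of_prescribed_area`). The slopes of the `w_j` converge to a slope
`θ`, so fast that the components of `w_j` and of `v_j` transverse to `(θ, 1)` satisfy
`∑ |α + 2 ∑_{i<j} (k_i - l_i θ)| < ∞` and `∑ l_j |k_j - l_j θ| < ∞` (`exists_slit_directions`).

**Non-ergodicity.** The first return map of the vertical flow to the real axis is a rotation by
`θ` together with an exchange of the sheets on an arc of length `α`. A slit with transverse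
component `β` is counted by `floorCount β x = ⌊x⌋ - ⌊x - β⌋`. Replacing the slit `w_j` by
`w_j + 2v_j` changes this cocycle mod 2 by the coboundary of `transferStep`, because the two
copies of `v_j` are translates of each other along the flow (`even_floorCount_step`). By
Borel–Cantelli the sums `transferSum` are eventually constant almost everywhere, while the cocycle
of the `j`-th slit eventually vanishes. In the limit the original cocycle is the coboundary of the
parity of the limit sum, and comparing that parity with the sheet gives an invariant set, which
meets the two sheets in complementary sets (`isVerticallySaturated_invariantSet`,
`not_isVerticallyErgodic_surface`).

**The systole.** At the time `t` with `e^{t/2} = l_j` the vector `v_j` has bounded length. The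
holonomy of a saddle connection is an integer vector or differs from `± α` by one, so either it is
a multiple of `v_j`, of length at least `1`, or its cross product with `v_j`, which the flow
preserves, is at least `4^{-j} / 2` (`le_norm_of_isSaddleConnection`). Hence `d(t)` is at most a
constant depending on `j` only, whereas `r(t)` is as large as desired when `l_j` is.
-/

noncomputable section

/-! ### Surfaces with cone charts -/

/-- Complex charts on a surface, together with an order at each point: the flat cone angle at `s` is
`2π * order s`, and the chart at `s` is an `order s`-th root of a translation coordinate. Every
point `s` carries one chart `chart s`, whose domain contains no cone point except possibly `s`
itself, and a cone point is the centre of its chart. The powers `chart s ^ order s` differ by local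
constants (`compat`), so that their differentials fit together to a holomorphic `1`-form. -/
structure ConeAtlas (S : Type) [TopologicalSpace S] where
  chart : S → OpenPartialHomeomorph S ℂ
  order : S → ℕ
  order_pos : ∀ s, 0 < order s
  mem_source : ∀ s, s ∈ (chart s).source
  eq_center : ∀ s, ∀ x ∈ (chart s).source, 1 < order x → x = s
  chart_center : ∀ s, 1 < order s → chart s s = 0
  compat : ∀ s s' : S, ∀ x ∈ (chart s).source, x ∈ (chart s').source →
    ∃ c : ℂ, ∀ᶠ y in 𝓝 x, chart s' y ^ order s' = chart s y ^ order s + c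

namespace ConeAtlas

variable {S : Type} [TopologicalSpace S] (A : ConeAtlas S)

/-- The developing map `∫ ω` in the chart at `s`. -/
def dev (s x : S) : ℂ := A.chart s x ^ A.order s

/-- The underlying space, as a type that carries the complex structure given by the cone atlas. -/
def Space (_ : ConeAtlas S) : Type := S

instance : TopologicalSpace A.Space := inferInstanceAs (TopologicalSpace S)

instance : ChartedSpace ℂ A.Space where
  atlas := Set.range A.chart
  chartAt := A.chart
  mem_chart_source := A.mem_source
  chart_mem_atlas s := ⟨s, rfl⟩

variable {A}

/-- The developing map in the chart at `s` has nonzero derivative away from the cone points. -/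
lemma chart_pow_deriv_ne_zero {s x : S} (hx : x ∈ (A.chart s).source) (h : A.order x ≤ 1) :
    (A.order s : ℂ) * A.chart s x ^ (A.order s - 1) ≠ 0 := by
  have h0 := A.order_pos s
  refine mul_ne_zero (by exact_mod_cast h0.ne') ?_
  by_cases hs : 1 < A.order s
  · refine pow_ne_zero _ fun h1 => ?_
    have : x = s := (A.chart s).injOn hx (A.mem_source s) (by rw [h1, A.chart_center s hs])
    subst this
    omega
  · have : A.order s - 1 = 0 := by omega
    simp [this]

/-- At a cone point both charts agree; elsewhere the transition map is a branch of
`u ↦ (u ^ order s + c) ^ (1 / order s')`, by the inverse function theorem. -/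
lemma differentiableAt_transition {s s' x : S} (hx : x ∈ (A.chart s).source)
    (hx' : x ∈ (A.chart s').source) :
    DifferentiableAt ℂ (A.chart s' ∘ (A.chart s).symm) (A.chart s x) := by
  set e := A.chart s
  have hinv : ∀ᶠ u in 𝓝 (e x), e (e.symm u) = u := by
    filter_upwards [e.open_target.mem_nhds (e.map_source hx)] with u hu using e.right_inv hu
  by_cases h : 1 < A.order x
  · obtain rfl := A.eq_center s x hx h
    obtain rfl := A.eq_center s' x hx' h
    exact differentiableAt_id.congr_of_eventuallyEq hinv
  have hne := A.chart_pow_deriv_ne_zero hx' (not_lt.1 h)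
  have hstr : HasStrictDerivAt (fun z : ℂ => z ^ A.order s')
      ((A.order s' : ℂ) * A.chart s' x ^ (A.order s' - 1)) (A.chart s' x) := by
    simpa using hasStrictDerivAt_pow (A.order s') (A.chart s' x)
  obtain ⟨c, hc⟩ := A.compat s s' x hx hx'
  have hcont : Tendsto e.symm (𝓝 (e x)) (𝓝 x) := e.tendsto_symm hx
  have hcont' : Tendsto (A.chart s') (𝓝 x) (𝓝 (A.chart s' x)) :=
    (A.chart s').continuousAt hx'
  have hloc := (hcont'.comp hcont).eventually (hstr.eventually_left_inverse hne)
  have hd := (hstr.to_localInverse hne).hasStrictFDerivAt.hasFDerivAt.differentiableAt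
  have hval : A.chart s' x ^ A.order s' = e x ^ A.order s + c := hc.self_of_nhds
  simp only [hval] at hd
  have hd' : DifferentiableAt ℂ (hstr.localInverse _ _ _ hne)
      ((fun u : ℂ => u ^ A.order s + c) (e x)) := hd
  have := DifferentiableAt.comp (f := fun u : ℂ => u ^ A.order s + c) (e x) hd' (by fun_prop)
  refine this.congr_of_eventuallyEq ?_
  filter_upwards [hloc, hcont.eventually hc, hinv] with u hu hu' hu''
  simp only [Function.comp_apply] at hu ⊢
  rw [← hu, hu', hu'']

variable (A) in
instance isManifold (n) : IsManifold 𝓘(ℂ) n A.Space := by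
  refine isManifold_of_contDiffOn _ _ _ ?_
  rintro _ _ ⟨s, rfl⟩ ⟨s', rfl⟩
  simp only [modelWithCornersSelf_coe, modelWithCornersSelf_coe_symm, Function.comp_id,
    Function.id_comp, Set.preimage_id, Set.range_id, Set.inter_univ]
  refine DifferentiableOn.contDiffOn (fun u hu => ?_)
    ((A.chart s).symm.trans (A.chart s')).open_source
  have h1 : u ∈ (A.chart s).target := hu.1
  have h2 : (A.chart s).symm u ∈ (A.chart s').source := hu.2
  have := A.differentiableAt_transition ((A.chart s).map_target h1) h2
  rw [(A.chart s).right_inv h1] at this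
  exact this.differentiableWithinAt

lemma mdifferentiableAt_chart {s x : S} (hx : x ∈ (A.chart s).source) :
    MDifferentiableAt (M := A.Space) 𝓘(ℂ) 𝓘(ℂ) (A.chart s) x :=
  mdifferentiableAt_atlas (M := A.Space) (I := 𝓘(ℂ)) (Set.mem_range_self s) hx

lemma mdifferentiableAt_chart_symm {s : S} {u : ℂ} (hu : u ∈ (A.chart s).target) :
    MDifferentiableAt (M' := A.Space) 𝓘(ℂ) 𝓘(ℂ) (A.chart s).symm u :=
  mdifferentiableAt_atlas_symm (M := A.Space) (I := 𝓘(ℂ)) (Set.mem_range_self s) hu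

lemma mdifferentiableAt_dev {s x : S} (hx : x ∈ (A.chart s).source) :
    MDifferentiableAt (M := A.Space) 𝓘(ℂ) 𝓘(ℂ) (A.dev s) x := by
  have h : MDifferentiableAt 𝓘(ℂ) 𝓘(ℂ) (fun z : ℂ => z ^ A.order s) (A.chart s x) :=
    (differentiableAt_pow (A.order s)).mdifferentiableAt
  exact h.comp (M := A.Space) x (mdifferentiableAt_chart hx)

/-- The differential of a complex function on the surface, with values in `ℂ`. -/
def diff (A : ConeAtlas S) (f : S → ℂ) (x : A.Space) : TangentSpace 𝓘(ℂ) x →L[ℂ] ℂ :=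
  (NormedSpace.fromTangentSpace (f x)).toContinuousLinearMap ∘L
    mfderiv (M := A.Space) 𝓘(ℂ) 𝓘(ℂ) f x

/-- The chain rule for `diff` in a chart. -/
lemma fderiv_comp_symm {s : S} {u : ℂ} (hu : u ∈ (A.chart s).target) {f : S → ℂ}
    (hf : MDifferentiableAt (M := A.Space) 𝓘(ℂ) 𝓘(ℂ) f ((A.chart s).symm u)) (v : ℂ) :
    fderiv ℂ (f ∘ (A.chart s).symm) u v =
      A.diff f ((A.chart s).symm u) (mfderiv (M' := A.Space) 𝓘(ℂ) 𝓘(ℂ) (A.chart s).symm u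
        ((NormedSpace.fromTangentSpace u).symm v)) := by
  have := mfderiv_comp (M' := A.Space) (I' := 𝓘(ℂ)) u hf (mdifferentiableAt_chart_symm hu)
  exact congrArg (fun L : ℂ →L[ℂ] ℂ => L v) (mfderiv_eq_fderiv.symm.trans this)

lemma differentiableAt_comp_symm {s : S} {u : ℂ} (hu : u ∈ (A.chart s).target) {f : S → ℂ}
    (hf : MDifferentiableAt (M := A.Space) 𝓘(ℂ) 𝓘(ℂ) f ((A.chart s).symm u)) :
    DifferentiableAt ℂ (f ∘ (A.chart s).symm) u :=
  (hf.comp (M' := A.Space) u (mdifferentiableAt_chart_symm hu)).differentiableAt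

lemma hasMFDerivAt_of_eventually {f g : S → ℂ} {x : A.Space} {c : ℂ}
    (hg : MDifferentiableAt (M := A.Space) 𝓘(ℂ) 𝓘(ℂ) g x) (h : ∀ᶠ y in 𝓝 x, f y = g y + c) :
    MDifferentiableAt (M := A.Space) 𝓘(ℂ) 𝓘(ℂ) f x ∧ A.diff f x = A.diff g x := by
  have h1 : MDifferentiableAt 𝓘(ℂ) 𝓘(ℂ) (fun z : ℂ => z + c) (g x) :=
    DifferentiableAt.mdifferentiableAt (by fun_prop)
  have hfg : f =ᶠ[𝓝 x] (fun z : ℂ => z + c) ∘ g := h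
  have h2 := h1.comp (M := A.Space) x hg
  refine ⟨h2.congr_of_eventuallyEq hfg, ContinuousLinearMap.ext fun v => ?_⟩
  have h3 := hfg.mfderiv_eq (M := A.Space) (I := 𝓘(ℂ)) (I' := 𝓘(ℂ))
  rw [mfderiv_comp (M := A.Space) x h1 hg] at h3
  have h4 : mfderiv 𝓘(ℂ) 𝓘(ℂ) (fun z : ℂ => z + c) (g x) = ContinuousLinearMap.id ℂ ℂ := by
    rw [mfderiv_eq_fderiv, fderiv_add_const, fderiv_fun_id]
  simp only [diff, h3]
  erw [h4]
  rfl

lemma diff_dev_eq {s x : S} (hx : x ∈ (A.chart s).source) :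
    A.diff (A.dev s) x = A.diff (A.dev x) x := by
  obtain ⟨c, hc⟩ := A.compat x s x (A.mem_source x) hx
  exact (hasMFDerivAt_of_eventually (mdifferentiableAt_dev (A.mem_source x)) hc).2

/-- The `1`-form reads `n u ^ (n - 1) du` in a chart of order `n`. -/
lemma deriv_dev_comp_symm {s : S} {u : ℂ} (hu : u ∈ (A.chart s).target) :
    fderiv ℂ (A.dev s ∘ (A.chart s).symm) u 1 = A.order s * u ^ (A.order s - 1) := by
  have : A.dev s ∘ (A.chart s).symm =ᶠ[𝓝 u] fun u => u ^ A.order s := by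
    filter_upwards [(A.chart s).open_target.mem_nhds hu] with v hv
    simp [dev, (A.chart s).right_inv hv]
  rw [this.fderiv_eq, fderiv_apply_one_eq_deriv]
  simp

lemma diff_dev_eq_zero_iff (x : A.Space) : A.diff (A.dev x) x = 0 ↔ 1 < A.order x := by
  have hx := A.mem_source x
  have h := fderiv_comp_symm (A := A) ((A.chart x).map_source hx) (f := A.dev x)
    (by rw [(A.chart x).left_inv hx]; exact mdifferentiableAt_dev hx) 1
  rw [deriv_dev_comp_symm ((A.chart x).map_source hx), (A.chart x).left_inv hx] at h
  constructor
  · intro h0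
    by_contra h1
    refine A.chart_pow_deriv_ne_zero hx (not_lt.1 h1) ?_
    rw [h, h0]
    rfl
  · intro h1
    rw [A.chart_center x h1, zero_pow (by omega), mul_zero] at h
    have hd : MDifferentiableAt 𝓘(ℂ) 𝓘(ℂ) (fun z : ℂ => z ^ A.order x) (A.chart x x) :=
      (differentiableAt_pow (A.order x)).mdifferentiableAt
    have h2 := mfderiv_comp (M := A.Space) x hd (mdifferentiableAt_chart hx)
    refine ContinuousLinearMap.ext fun v : TangentSpace (M := A.Space) 𝓘(ℂ) x => ?_
    have h3 : mfderiv 𝓘(ℂ) 𝓘(ℂ) (fun z : ℂ => z ^ A.order x) (A.chart x x) =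
        (0 : ℂ →L[ℂ] ℂ) := by
      rw [mfderiv_eq_fderiv]
      ext
      rw [fderiv_apply_one_eq_deriv]
      simp [A.chart_center x h1, zero_pow (show A.order x - 1 ≠ 0 by omega)]
    have h4 : A.diff (A.dev x) x v = NormedSpace.fromTangentSpace (A.dev x x)
      (mfderiv (M := A.Space) 𝓘(ℂ) 𝓘(ℂ) ((fun z : ℂ => z ^ A.order x) ∘ A.chart x) x v) := rfl
    rw [h4, h2]
    erw [h3]
    rfl

/-- The translation surface of a cone atlas: `ω` is the differential of the developing maps. Some
point has to be regular, so that `ω` is not identically zero. -/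
def toTranslationSurface (A : ConeAtlas S) [T2Space S] [CompactSpace S] [ConnectedSpace S]
    (hreg : ∃ x, A.order x ≤ 1) : TranslationSurface where
  carrier := A.Space
  t2 := inferInstanceAs (T2Space S)
  compact := inferInstanceAs (CompactSpace S)
  connected := inferInstanceAs (ConnectedSpace S)
  form x := A.diff (A.dev x) x
  holomorphic s := by
    have : DifferentiableOn ℂ (fun u : ℂ => A.order s * u ^ (A.order s - 1))
      (A.chart s).target := by fun_prop
    refine this.congr fun u hu => ?_
    have hu' := (A.chart s).map_target hu
    have h := fderiv_comp_symm (A := A) hu (mdifferentiableAt_dev hu') 1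
    rw [deriv_dev_comp_symm hu, diff_dev_eq hu'] at h
    exact h.symm
  form_ne_zero := by
    obtain ⟨x, hx⟩ := hreg
    exact ⟨x, fun h => by have := (diff_dev_eq_zero_iff x).1 h; omega⟩

variable [T2Space S] [CompactSpace S] [ConnectedSpace S] {hreg : ∃ x, A.order x ≤ 1}

lemma mem_zeros_iff {x : A.Space} :
    x ∈ (A.toTranslationSurface hreg).zeros ↔ 1 < A.order x :=
  diff_dev_eq_zero_iff x

/-- The natural parameters are the coordinates that differ from the developing maps by local
constants. -/
lemma isNaturalParameter_iff (φ : OpenPartialHomeomorph S ℂ) :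
    (A.toTranslationSurface hreg).IsNaturalParameter φ ↔
      ∀ x ∈ φ.source, A.order x ≤ 1 ∧ ∃ c : ℂ, ∀ᶠ y in 𝓝 x, φ y = A.dev x y + c := by
  have key : ∀ (x : A.Space), (∀ v : TangentSpace 𝓘(ℂ) x, NormedSpace.fromTangentSpace (φ x)
      (mfderiv (M := A.Space) 𝓘(ℂ) 𝓘(ℂ) φ x v) = A.diff (A.dev x) x v) ↔
      A.diff φ x = A.diff (A.dev x) x := fun x =>
    ⟨fun h => ContinuousLinearMap.ext h, fun h v => by rw [← h]; rfl⟩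
  constructor
  · intro h x hx
    have hx' := h x hx
    refine ⟨not_lt.1 fun h1 => hx'.1 ((mem_zeros_iff (A := A) (S := S)).2 h1), ?_⟩
    have hs := A.mem_source x
    set e := A.chart x
    have hV : IsOpen (e.target ∩ e.symm ⁻¹' φ.source) :=
      e.symm.isOpen_inter_preimage φ.open_source
    have hxV : e x ∈ e.target ∩ e.symm ⁻¹' φ.source :=
      ⟨e.map_source hs, by simpa [e.left_inv hs] using hx⟩
    obtain ⟨ρ, hρ, hball⟩ := Metric.isOpen_iff.1 hV _ hxV
    have hmd : ∀ u ∈ Metric.ball (e x) ρ,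
        MDifferentiableAt (M := A.Space) 𝓘(ℂ) 𝓘(ℂ) φ (e.symm u) := fun u hu =>
      (h _ (hball hu).2).2.1
    -- in the chart at `x` the difference of `φ` and the developing map has zero derivative
    have hconst : ∀ u ∈ Metric.ball (e x) ρ, (φ ∘ e.symm) u - (A.dev x ∘ e.symm) u =
        (φ ∘ e.symm) (e x) - (A.dev x ∘ e.symm) (e x) := by
      intro u hu
      refine Metric.isOpen_ball.is_const_of_fderiv_eq_zero (𝕜 := ℂ)
        (f := fun u => (φ ∘ e.symm) u - (A.dev x ∘ e.symm) u)
        (convex_ball _ _).isPreconnected ?_ ?_ hu (Metric.mem_ball_self hρ)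
      · intro u hu
        exact ((differentiableAt_comp_symm (hball hu).1 (hmd u hu)).sub
          (differentiableAt_comp_symm (hball hu).1 (mdifferentiableAt_dev
            (e.map_target (hball hu).1)))).differentiableWithinAt
      · intro u hu
        have hu1 := (hball hu).1
        have hd2 := mdifferentiableAt_dev (A := A) (e.map_target hu1)
        ext
        rw [fderiv_fun_sub (differentiableAt_comp_symm hu1 (hmd u hu))
          (differentiableAt_comp_symm hu1 hd2), sub_apply,
          fderiv_comp_symm hu1 (hmd u hu), fderiv_comp_symm hu1 hd2,
          diff_dev_eq (e.map_target hu1), (key _).1 (h _ (hball hu).2).2.2, sub_self]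
        rfl
    refine ⟨φ x - A.dev x x, ?_⟩
    have hb : ∀ᶠ y in 𝓝 x, e y ∈ Metric.ball (e x) ρ :=
      (e.continuousAt hs).eventually (Metric.ball_mem_nhds _ hρ)
    filter_upwards [hb, e.open_source.mem_nhds hs] with y hy hy'
    have := hconst _ hy
    simp only [Function.comp_apply, e.left_inv hy', e.left_inv hs] at this
    rw [← this]
    ring
  · intro h x hx
    obtain ⟨h1, c, hc⟩ := h x hx
    have := hasMFDerivAt_of_eventually (mdifferentiableAt_dev (A.mem_source x)) hc
    exact ⟨fun h2 => by have := (mem_zeros_iff (A := A) (S := S)).1 h2; omega, this.1,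
      (key x).2 this.2⟩

end ConeAtlas

/-! ### Linear images of cone charts -/

/-- The lift of `G` through the `n`-th power map: a branch of `(G (u ^ n)) ^ (1 / n)` that is
globally continuous, if `G` never turns a vector by the angle `π`. Its value at `0` is `0`. -/
def coneLift (n : ℕ) (G : ℂ ≃L[ℝ] ℂ) (u : ℂ) : ℂ :=
  u * (G (u ^ n) / u ^ n) ^ ((n : ℂ)⁻¹)

/-- `G` maps no nonzero vector to a nonpositive multiple of itself, so that the principal branch
of a root of `G z / z` is continuous. -/
def PreservesRays (G : ℂ ≃L[ℝ] ℂ) : Prop := ∀ z ≠ 0, G z / z ∈ Complex.slitPlane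

lemma Complex.inv_mem_slitPlane {z : ℂ} (hz : z ∈ Complex.slitPlane) :
    z⁻¹ ∈ Complex.slitPlane := by
  have h := Complex.mem_slitPlane_iff_arg.1 hz
  refine Complex.mem_slitPlane_iff_arg.2 ⟨?_, inv_ne_zero h.2⟩
  rw [Complex.arg_inv, if_neg h.1]
  intro h'
  exact (Complex.neg_pi_lt_arg z).ne (by rw [← h', neg_neg])

lemma PreservesRays.symm {G : ℂ ≃L[ℝ] ℂ} (hG : PreservesRays G) : PreservesRays G.symm := by
  intro z hz
  have h := hG (G.symm z) (by simpa using hz)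
  rw [G.apply_symm_apply] at h
  rw [← inv_div]
  exact Complex.inv_mem_slitPlane h

lemma coneLift_pow {n : ℕ} (hn : 0 < n) (G : ℂ ≃L[ℝ] ℂ) (u : ℂ) :
    coneLift n G u ^ n = G (u ^ n) := by
  rcases eq_or_ne u 0 with rfl | hu
  · simp [coneLift, hn.ne']
  · rw [coneLift, mul_pow, Complex.cpow_nat_inv_pow _ hn.ne']
    field_simp

lemma coneLift_symm_coneLift {n : ℕ} (hn : 0 < n) {G : ℂ ≃L[ℝ] ℂ} (hG : PreservesRays G) (u : ℂ) :
    coneLift n G.symm (coneLift n G u) = u := by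
  rcases eq_or_ne u 0 with rfl | hu
  · simp [coneLift]
  have hun : u ^ n ≠ 0 := pow_ne_zero _ hu
  have hG0 : G (u ^ n) ≠ 0 := by simpa using hun
  rw [coneLift, coneLift_pow hn, G.symm_apply_apply, coneLift,
    ← inv_div (G (u ^ n)), Complex.inv_cpow _ _ (Complex.mem_slitPlane_iff_arg.1 (hG _ hun)).1,
    mul_assoc, mul_inv_cancel₀, mul_one]
  exact (Complex.cpow_ne_zero_iff_of_exponent_ne_zero (by simp [hn.ne'])).2 (div_ne_zero hG0 hun)

lemma continuous_coneLift {n : ℕ} (hn : 0 < n) {G : ℂ ≃L[ℝ] ℂ} (hG : PreservesRays G) :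
    Continuous (coneLift n G) := by
  rw [continuous_iff_continuousAt]
  intro u
  rcases eq_or_ne u 0 with rfl | hu
  -- at the origin, where the quotient is not continuous, the norm is controlled
  · have hnorm : ∀ u : ℂ, ‖coneLift n G u‖ = ‖G (u ^ n)‖ ^ ((n : ℝ)⁻¹) := fun u => by
      rw [← coneLift_pow hn, norm_pow, Real.pow_rpow_inv_natCast (norm_nonneg _) hn.ne']
    have h0 : coneLift n G 0 = 0 := by simp [coneLift]
    rw [ContinuousAt, h0, tendsto_zero_iff_norm_tendsto_zero]
    simp_rw [hnorm]
    have : Continuous fun u : ℂ => ‖G (u ^ n)‖ ^ ((n : ℝ)⁻¹) := by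
      refine Continuous.rpow_const (by fun_prop) fun _ => Or.inr (by positivity)
    simpa [hn.ne'] using this.tendsto 0
  · have hun : u ^ n ≠ 0 := pow_ne_zero _ hu
    refine continuousAt_id.mul (ContinuousAt.cpow ?_ continuousAt_const (hG _ hun))
    exact ContinuousAt.div (by fun_prop) (by fun_prop) hun

/-- The lift of `G` through the `n`-th power map as a homeomorphism, with the lift of `G⁻¹` as
inverse. -/
def coneLiftHomeomorph {n : ℕ} (hn : 0 < n) (G : ℂ ≃L[ℝ] ℂ) (hG : PreservesRays G) : ℂ ≃ₜ ℂ where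
  toFun := coneLift n G
  invFun := coneLift n G.symm
  left_inv := coneLift_symm_coneLift hn hG
  right_inv := coneLift_symm_coneLift hn hG.symm
  continuous_toFun := continuous_coneLift hn hG
  continuous_invFun := continuous_coneLift hn hG.symm

namespace ConeAtlas

variable {S : Type} [TopologicalSpace S] (A : ConeAtlas S)

/-- The cone atlas whose translation coordinates are post-composed with the linear map `G`. -/
def map (G : ℂ ≃L[ℝ] ℂ) (hG : PreservesRays G) : ConeAtlas S where
  chart s := (A.chart s).transHomeomorph (coneLiftHomeomorph (A.order_pos s) G hG)
  order := A.order
  order_pos := A.order_pos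
  mem_source := A.mem_source
  eq_center := A.eq_center
  chart_center s hs := by
    have h : coneLift (A.order s) G (A.chart s s) = 0 := by simp [coneLift, A.chart_center s hs]
    exact h
  compat s s' x hx hx' := by
    obtain ⟨c, hc⟩ := A.compat s s' x hx hx'
    refine ⟨G c, hc.mono fun y hy => ?_⟩
    have h (s : S) : (A.chart s).transHomeomorph (coneLiftHomeomorph (A.order_pos s) G hG) y =
      coneLift (A.order s) G (A.chart s y) := rfl
    rw [h, h, coneLift_pow (A.order_pos _), coneLift_pow (A.order_pos _), hy, map_add]

lemma map_dev (G : ℂ ≃L[ℝ] ℂ) (hG : PreservesRays G) (s x : S) :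
    (A.map G hG).dev s x = G (A.dev s x) :=
  coneLift_pow (A.order_pos s) G _

variable [T2Space S] [CompactSpace S] [ConnectedSpace S]

lemma isNaturalParameter_map_iff {G G' : ℂ ≃L[ℝ] ℂ} {hG : PreservesRays G}
    {hG' : PreservesRays G'} {h : ∃ x, (A.map G hG).order x ≤ 1}
    {h' : ∃ x, (A.map G' hG').order x ≤ 1} {t : ℝ} (ht : ∀ z, teichmullerMap t (G z) = G' z)
    {φ ψ : OpenPartialHomeomorph S ℂ} (hsrc : ψ.source = φ.source)
    (hfun : ∀ x, ψ x = teichmullerMap t (φ x)) :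
    ((A.map G hG).toTranslationSurface h).IsNaturalParameter φ ↔
      ((A.map G' hG').toTranslationSurface h').IsNaturalParameter ψ := by
  have hadd : ∀ z w, teichmullerMap t (z + w) = teichmullerMap t z + teichmullerMap t w := by
    intro z w
    apply Complex.ext <;> simp [teichmullerMap, mul_add]
  rw [isNaturalParameter_iff, isNaturalParameter_iff, hsrc]
  refine forall₂_congr fun x _ => and_congr Iff.rfl ?_
  constructor
  · rintro ⟨c, hc⟩
    refine ⟨teichmullerMap t c, hc.mono fun y hy => ?_⟩
    rw [hfun, hy, hadd, map_dev, map_dev, ht]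
  · rintro ⟨c, hc⟩
    refine ⟨(teichmullerMap t).symm c, hc.mono fun y hy => (teichmullerMap t).injective ?_⟩
    rw [← hfun, hy, hadd, map_dev, map_dev, ht, Homeomorph.apply_symm_apply]

/-- The Teichmüller map between the images of one cone atlas under `G` and under `g_t ∘ G` is the
identity of the underlying space. -/
lemma isEvolution_map {G G' : ℂ ≃L[ℝ] ℂ} {hG : PreservesRays G} {hG' : PreservesRays G'}
    {h : ∃ x, (A.map G hG).order x ≤ 1} {h' : ∃ x, (A.map G' hG').order x ≤ 1} {t : ℝ}
    (ht : ∀ z, teichmullerMap t (G z) = G' z) :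
    ((A.map G hG).toTranslationSurface h).IsEvolution t
      ((A.map G' hG').toTranslationSurface h') :=
  ⟨Homeomorph.refl S, fun _ => A.isNaturalParameter_map_iff ht
    (Set.ext fun _ => ⟨fun hx => hx.1.2, fun hx => ⟨⟨trivial, hx⟩, trivial⟩⟩) fun _ => rfl⟩

end ConeAtlas

/-! ### The slit torus double cover -/

lemma Complex.sqrt_sq (w : ℂ) : w.sqrt ^ 2 = w := by
  rw [Complex.sqrt]
  exact Complex.cpow_ofNat_inv_pow w 2

lemma Complex.sqrt_ne_zero {w : ℂ} (hw : w ≠ 0) : w.sqrt ≠ 0 := by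
  intro h
  exact hw (by rw [← Complex.sqrt_sq w, h]; simp)

lemma Complex.re_sqrt_pos {w : ℂ} (hw : w ∈ Complex.slitPlane) : 0 < w.sqrt.re := by
  rw [Complex.sqrt, Complex.cpow_inv_two_re]
  refine Real.sqrt_pos.2 (div_pos ?_ two_pos)
  rcases Complex.mem_slitPlane_iff.1 hw with h | h
  · positivity
  · have := Complex.abs_re_lt_norm.2 h
    linarith [neg_abs_le w.re]

/-- The torus `(ℝ / ℤ)²`. -/
abbrev Torus : Type := UnitAddCircle × UnitAddCircle

/-- The projection of `ℂ` onto the torus `ℂ / ℤ[i]`. -/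
def toTorus : ℂ →+ Torus where
  toFun z := (z.re, z.im)
  map_zero' := by simp
  map_add' z w := by simp

lemma toTorus_apply (z : ℂ) : toTorus z = ((z.re : UnitAddCircle), (z.im : UnitAddCircle)) := rfl

@[fun_prop]
lemma continuous_toTorus : Continuous toTorus := by
  change Continuous fun z : ℂ => (((z.re : ℝ) : UnitAddCircle), ((z.im : ℝ) : UnitAddCircle))
  exact ((AddCircle.continuous_mk' 1).comp Complex.continuous_re).prodMk
    ((AddCircle.continuous_mk' 1).comp Complex.continuous_im)

lemma toTorus_surjective : Function.Surjective toTorus := by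
  rintro ⟨x, y⟩
  obtain ⟨x, rfl⟩ := QuotientAddGroup.mk_surjective x
  obtain ⟨y, rfl⟩ := QuotientAddGroup.mk_surjective y
  exact ⟨⟨x, y⟩, rfl⟩

lemma toTorus_eq_zero_iff {z : ℂ} : toTorus z = 0 ↔ ∃ m n : ℤ, z = ⟨m, n⟩ := by
  rw [toTorus_apply, Prod.mk_eq_zero, AddCircle.coe_eq_zero_iff, AddCircle.coe_eq_zero_iff]
  simp only [Complex.ext_iff, zsmul_eq_mul, mul_one]
  constructor
  · rintro ⟨⟨m, hm⟩, n, hn⟩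
    exact ⟨m, n, hm.symm, hn.symm⟩
  · rintro ⟨m, n, hm, hn⟩
    exact ⟨⟨m, hm.symm⟩, n, hn.symm⟩

lemma eq_zero_of_toTorus_eq_zero {z : ℂ} (h : toTorus z = 0) (hz : ‖z‖ < 1) : z = 0 := by
  obtain ⟨m, n, rfl⟩ := toTorus_eq_zero_iff.1 h
  have hm : |(m : ℝ)| < 1 := (Complex.abs_re_le_norm ⟨m, n⟩).trans_lt hz
  have hn : |(n : ℝ)| < 1 := (Complex.abs_im_le_norm ⟨m, n⟩).trans_lt hz
  have hm' : m = 0 := Int.abs_lt_one_iff.1 (by exact_mod_cast hm)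
  have hn' : n = 0 := Int.abs_lt_one_iff.1 (by exact_mod_cast hn)
  subst hm' hn'
  simp [Complex.ext_iff]

/-- Two continuous functions whose projections to the torus differ by a constant differ by a
constant themselves, locally. -/
lemma eventually_eq_add_of_toTorus {X : Type*} [TopologicalSpace X] {f g : X → ℂ} {x : X}
    (hf : ContinuousAt f x) (hg : ContinuousAt g x) {τ : Torus}
    (h : ∀ᶠ y in 𝓝 x, toTorus (f y) = toTorus (g y) + τ) :
    ∀ᶠ y in 𝓝 x, f y = g y + (f x - g x) := by
  have hc : ContinuousAt (fun y => f y - g y - (f x - g x)) x :=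
    (hf.sub hg).sub continuousAt_const
  have hev : ∀ᶠ y in 𝓝 x, f y - g y - (f x - g x) ∈ Metric.ball (0 : ℂ) 1 :=
    hc.eventually (Metric.isOpen_ball.mem_nhds (by simp))
  filter_upwards [h, hev] with y hy hy'
  have := eq_zero_of_toTorus_eq_zero (z := f y - g y - (f x - g x))
    (by rw [map_sub, map_sub, map_sub, hy, h.self_of_nhds]; abel) (by simpa using hy')
  linear_combination this

/-- The inverse of the chart of the torus given by the open unit square with centre `c`: the
projection `toTorus` restricted to that square. -/
def boxChart (c : ℂ) : OpenPartialHomeomorph ℂ Torus :=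
  Complex.equivRealProdCLM.toHomeomorph.toOpenPartialHomeomorph.trans
    ((AddCircle.openPartialHomeomorphCoe 1 (c.re - 1 / 2)).prod
      (AddCircle.openPartialHomeomorphCoe 1 (c.im - 1 / 2)))

lemma mem_boxChart_source {c z : ℂ} :
    z ∈ (boxChart c).source ↔ |z.re - c.re| < 1 / 2 ∧ |z.im - c.im| < 1 / 2 := by
  simp only [boxChart, OpenPartialHomeomorph.trans_source,
    Homeomorph.toOpenPartialHomeomorph_source, Set.univ_inter,
    OpenPartialHomeomorph.prod_source, AddCircle.openPartialHomeomorphCoe_source,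
    Set.mem_preimage, abs_lt]
  change ((_ < z.re ∧ z.re < _) ∧ (_ < z.im ∧ z.im < _)) ↔ _
  constructor <;> rintro ⟨⟨_, _⟩, _, _⟩ <;> refine ⟨⟨?_, ?_⟩, ?_, ?_⟩ <;> linarith

lemma boxChart_self (c : ℂ) : c ∈ (boxChart c).source := mem_boxChart_source.2 (by simp)

/-- The function `F = cos 2πa - cos 2πx + 1 - cos 2πy + i sin 2πy` on the torus. For
`0 < a < 1 / 2` it takes negative real values exactly on the open slit `y = 0`, `|x| < a`, and
vanishes exactly at the ends of the slit. -/
def slitFun (a : ℝ) (τ : Torus) : ℂ :=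
  ⟨Real.cos (2 * Real.pi * a) - (AddCircle.toCircle τ.1 : ℂ).re +
    (1 - (AddCircle.toCircle τ.2 : ℂ).re), (AddCircle.toCircle τ.2 : ℂ).im⟩

@[fun_prop]
lemma continuous_slitFun (a : ℝ) : Continuous (slitFun a) := by
  have h1 : Continuous fun τ : Torus => (AddCircle.toCircle τ.1 : ℂ) :=
    continuous_subtype_val.comp (AddCircle.continuous_toCircle.comp continuous_fst)
  have h2 : Continuous fun τ : Torus => (AddCircle.toCircle τ.2 : ℂ) :=
    continuous_subtype_val.comp (AddCircle.continuous_toCircle.comp continuous_snd)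
  unfold slitFun
  simp only [Complex.mk_eq_add_mul_I]
  fun_prop

lemma toCircle_coe_re (x : ℝ) :
    (AddCircle.toCircle (x : UnitAddCircle) : ℂ).re = Real.cos (2 * Real.pi * x) := by
  rw [AddCircle.toCircle_apply_mk, Circle.coe_exp, Complex.exp_ofReal_mul_I_re, div_one]

lemma toCircle_coe_im (x : ℝ) :
    (AddCircle.toCircle (x : UnitAddCircle) : ℂ).im = Real.sin (2 * Real.pi * x) := by
  rw [AddCircle.toCircle_apply_mk, Circle.coe_exp, Complex.exp_ofReal_mul_I_im, div_one]

lemma slitFun_toTorus_re (a : ℝ) (z : ℂ) : (slitFun a (toTorus z)).re =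
    Real.cos (2 * Real.pi * a) - Real.cos (2 * Real.pi * z.re) +
      (1 - Real.cos (2 * Real.pi * z.im)) := by
  rw [← toCircle_coe_re z.re, ← toCircle_coe_re z.im]
  rfl

lemma slitFun_toTorus_im (a : ℝ) (z : ℂ) :
    (slitFun a (toTorus z)).im = Real.sin (2 * Real.pi * z.im) :=
  toCircle_coe_im z.im

/-- The double cover `Y² = F` of the torus, branched over the ends of the slit: two copies of the
torus, glued crosswise along the slit. -/
def SlitTorus (a : ℝ) : Type := {s : Torus × ℂ // s.2 ^ 2 = slitFun a s.1}

namespace SlitTorus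

variable {a : ℝ}

instance : TopologicalSpace (SlitTorus a) := inferInstanceAs (TopologicalSpace {_s // _})
instance : T2Space (SlitTorus a) := inferInstanceAs (T2Space {_s // _})

/-- The projection of the double cover onto the torus. -/
def proj (s : SlitTorus a) : Torus := s.1.1

/-- The coordinate `Y` on the double cover. -/
def root (s : SlitTorus a) : ℂ := s.1.2

lemma root_sq (s : SlitTorus a) : s.root ^ 2 = slitFun a s.proj := s.2

@[fun_prop]
lemma continuous_proj : Continuous (proj : SlitTorus a → Torus) :=
  continuous_fst.comp continuous_subtype_val

@[fun_prop]
lemma continuous_root : Continuous (root : SlitTorus a → ℂ) :=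
  continuous_snd.comp continuous_subtype_val

lemma ext {s s' : SlitTorus a} (h : s.proj = s'.proj) (h' : s.root = s'.root) : s = s' :=
  Subtype.ext (Prod.ext h h')

lemma isInducing_proj_root :
    Topology.IsInducing fun s : SlitTorus a => (s.proj, s.root) :=
  Topology.IsInducing.subtypeVal

/-- The point over `τ` with a given square root of `F τ`. -/
def ofRoot (τ : Torus) (y : ℂ) (h : y ^ 2 = slitFun a τ) : SlitTorus a := ⟨(τ, y), h⟩

/-- The point over `τ` with `Y`-coordinate `y`. If `y` is not a square root of `F τ`, then the
principal square root takes its place. -/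
def mk' (a : ℝ) (τ : Torus) (y : ℂ) : SlitTorus a :=
  open Classical in
  if h : y ^ 2 = slitFun a τ then ofRoot τ y h
  else ofRoot τ (slitFun a τ).sqrt (Complex.sqrt_sq _)

lemma proj_mk' (τ : Torus) (y : ℂ) : (mk' a τ y).proj = τ := by
  unfold mk'
  split_ifs <;> rfl

lemma root_mk' {τ : Torus} {y : ℂ} (h : y ^ 2 = slitFun a τ) : (mk' a τ y).root = y := by
  rw [mk', dif_pos h]
  rfl

lemma continuousOn_mk' {X : Type*} [TopologicalSpace X] {s : Set X} {f : X → Torus} {g : X → ℂ}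
    (hf : ContinuousOn f s) (hg : ContinuousOn g s) (h : ∀ x ∈ s, g x ^ 2 = slitFun a (f x)) :
    ContinuousOn (fun x => mk' a (f x) (g x)) s := by
  rw [isInducing_proj_root.continuousOn_iff]
  exact (hf.prodMk hg).congr fun x hx => Prod.ext (proj_mk' _ _) (root_mk' (h x hx))

instance : CompactSpace (SlitTorus a) := by
  have hcl : IsClosed {s : Torus × ℂ | s.2 ^ 2 = slitFun a s.1} :=
    isClosed_eq (by fun_prop) (by fun_prop)
  obtain ⟨M, hM⟩ := (isCompact_range (continuous_slitFun a).norm).bddAbove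
  refine isCompact_iff_compactSpace.1 (((isCompact_univ (X := Torus)).prod
    (isCompact_closedBall (0 : ℂ) (M + 1))).of_isClosed_subset hcl ?_)
  intro s hs
  refine ⟨trivial, ?_⟩
  have h1 : ‖s.2‖ ^ 2 ≤ M := by
    rw [← norm_pow, hs]
    exact hM ⟨s.1, rfl⟩
  rw [mem_closedBall_zero_iff]
  nlinarith [norm_nonneg s.2]

/-- The coordinate `z` on the part of the double cover over `R` that is the image of the section
given by a continuous square root `σ` of `F`. The condition `0 < Re (Y / σ)` selects `Y = σ` and
excludes `Y = -σ`. -/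
def sectionChart (c : ℂ) (R : Set ℂ) (hR : IsOpen R) (hRc : R ⊆ (boxChart c).source) (σ : ℂ → ℂ)
    (hσ : ContinuousOn σ R) (hsq : ∀ z ∈ R, σ z ^ 2 = slitFun a (toTorus z))
    (hne : ∀ z ∈ R, σ z ≠ 0) : OpenPartialHomeomorph (SlitTorus a) ℂ where
  toFun s := (boxChart c).symm s.proj
  invFun z := mk' a (toTorus z) (σ z)
  source := (proj ⁻¹' ((boxChart c).target ∩ (boxChart c).symm ⁻¹' R)) ∩
    {s | 0 < (s.root / σ ((boxChart c).symm s.proj)).re}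
  target := R
  map_source' s hs := hs.1.2
  map_target' z hz := by
    have h1 : (boxChart c).symm (toTorus z) = z := (boxChart c).left_inv (hRc hz)
    simp only [Set.mem_inter_iff, Set.mem_preimage, Set.mem_ofPred_eq, proj_mk', h1,
      root_mk' (hsq z hz), div_self (hne z hz), Complex.one_re, zero_lt_one, and_true, hz]
    exact (boxChart c).map_source (hRc hz)
  left_inv' s hs := by
    obtain ⟨⟨hs1, hs2⟩, hs3⟩ := hs
    have h1 : toTorus ((boxChart c).symm s.proj) = s.proj := (boxChart c).right_inv hs1
    have h2 : s.root ^ 2 = σ ((boxChart c).symm s.proj) ^ 2 := by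
      rw [root_sq, hsq _ hs2, h1]
    rw [h1]
    refine ext (proj_mk' _ _) ?_
    rw [root_mk' (by rw [← h2, root_sq])]
    rcases sq_eq_sq_iff_eq_or_eq_neg.1 h2 with h | h
    · exact h.symm
    · exfalso
      rw [Set.mem_ofPred_eq, h, neg_div, div_self (hne _ hs2)] at hs3
      norm_num at hs3
  right_inv' z hz := by
    rw [proj_mk']
    exact (boxChart c).left_inv (hRc hz)
  open_source := by
    have hU : IsOpen (proj ⁻¹' ((boxChart c).target ∩ (boxChart c).symm ⁻¹' R) :
        Set (SlitTorus a)) :=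
      ((boxChart c).symm.isOpen_inter_preimage hR).preimage continuous_proj
    refine ContinuousOn.isOpen_inter_preimage (f := fun s : SlitTorus a =>
      (s.root / σ ((boxChart c).symm s.proj)).re) ?_ hU isOpen_Ioi
    refine Complex.continuous_re.comp_continuousOn ?_
    refine continuous_root.continuousOn.div (hσ.comp ?_ fun s hs => hs.2) fun s hs => hne _ hs.2
    exact (boxChart c).continuousOn_symm.comp continuous_proj.continuousOn fun s hs => hs.1
  open_target := hR
  continuousOn_toFun :=
    (boxChart c).continuousOn_symm.comp continuous_proj.continuousOn fun s hs => hs.1.1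
  continuousOn_invFun := continuousOn_mk' continuous_toTorus.continuousOn hσ hsq

lemma toTorus_sectionChart {c : ℂ} {R : Set ℂ} {hR : IsOpen R} {hRc : R ⊆ (boxChart c).source}
    {σ : ℂ → ℂ} {hσ : ContinuousOn σ R} {hsq : ∀ z ∈ R, σ z ^ 2 = slitFun a (toTorus z)}
    {hne : ∀ z ∈ R, σ z ≠ 0} {s : SlitTorus a}
    (hs : s ∈ (sectionChart c R hR hRc σ hσ hsq hne).source) :
    toTorus (sectionChart c R hR hRc σ hσ hsq hne s) = s.proj :=
  (boxChart c).right_inv hs.1.1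

lemma root_ne_zero_of_mem_sectionChart {c : ℂ} {R : Set ℂ} {hR : IsOpen R}
    {hRc : R ⊆ (boxChart c).source}
    {σ : ℂ → ℂ} {hσ : ContinuousOn σ R} {hsq : ∀ z ∈ R, σ z ^ 2 = slitFun a (toTorus z)}
    {hne : ∀ z ∈ R, σ z ≠ 0} {s : SlitTorus a}
    (hs : s ∈ (sectionChart c R hR hRc σ hσ hsq hne).source) : s.root ≠ 0 := by
  intro h
  have := hs.2
  simp [h] at this

end SlitTorus

/-! ### Charts at the cone points -/

lemma Complex.div_mem_slitPlane {w z : ℂ} (h : (0 < w.im ∧ 0 < z.im) ∨ (w.im < 0 ∧ z.im < 0) ∨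
    (w.im = 0 ∧ z.im = 0 ∧ 0 < w.re * z.re)) : w / z ∈ Complex.slitPlane := by
  have hz : z ≠ 0 := by
    rintro rfl
    simp at h
  have hN : 0 < Complex.normSq z := Complex.normSq_pos.2 hz
  rw [Complex.mem_slitPlane_iff, Complex.div_re, Complex.div_im, ← add_div, ← sub_div]
  by_cases h0 : w.im * z.re - w.re * z.im = 0
  · refine Or.inl (div_pos ?_ hN)
    have key : (w.re * z.re + w.im * z.im) * z.im = w.im * Complex.normSq z := by
      rw [Complex.normSq_apply]
      linear_combination -z.re * h0
    rcases h with ⟨h1, h2⟩ | ⟨h1, h2⟩ | ⟨h1, h2, h3⟩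
    · exact pos_of_mul_pos_left (by rw [key]; positivity) h2.le
    · exact pos_of_mul_neg_left (by rw [key]; exact mul_neg_of_neg_of_pos h1 hN) h2.le
    · simpa [h1, h2] using h3
  · exact Or.inr (div_ne_zero h0 hN.ne')

lemma Real.sin_two_pi_mul_pos {y : ℝ} (h0 : 0 < y) (h1 : y < 1 / 2) :
    0 < Real.sin (2 * Real.pi * y) :=
  Real.sin_pos_of_pos_of_lt_pi (by positivity) (by nlinarith [Real.pi_pos])

lemma Real.sin_two_pi_mul_neg {y : ℝ} (h0 : y < 0) (h1 : -(1 / 2) < y) :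
    Real.sin (2 * Real.pi * y) < 0 := by
  have := Real.sin_two_pi_mul_pos (y := -y) (by linarith) (by linarith)
  rw [mul_neg, Real.sin_neg] at this
  linarith

lemma Real.cos_two_pi_mul_lt {x y : ℝ} (h0 : 0 ≤ x) (h1 : x < y) (h2 : y ≤ 1 / 2) :
    Real.cos (2 * Real.pi * y) < Real.cos (2 * Real.pi * x) := by
  have := Real.pi_pos
  exact Real.cos_lt_cos_of_nonneg_of_le_pi (by positivity) (by nlinarith) (by nlinarith)

lemma slitFun_toTorus_ofReal (a x : ℝ) :
    slitFun a (toTorus x) = (Real.cos (2 * Real.pi * a) - Real.cos (2 * Real.pi * x) : ℝ) := by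
  apply Complex.ext
  · rw [slitFun_toTorus_re, Complex.ofReal_re, Complex.ofReal_re, Complex.ofReal_im]
    simp
  · rw [slitFun_toTorus_im, Complex.ofReal_im, Complex.ofReal_im]
    simp

lemma slitFun_center (a : ℝ) : slitFun a (toTorus a) = 0 := by
  rw [slitFun_toTorus_ofReal, sub_self, Complex.ofReal_zero]

/-- An open box around the end `a` of the slit; it does not meet the other end. -/
def coneBox : Set ℂ := {z | (0 < z.re ∧ z.re < 1 / 2) ∧ -(1 / 2) < z.im ∧ z.im < 1 / 2}

lemma isOpen_coneBox : IsOpen coneBox :=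
  ((isOpen_lt continuous_const Complex.continuous_re).inter
    (isOpen_lt Complex.continuous_re continuous_const)).inter
    ((isOpen_lt continuous_const Complex.continuous_im).inter
    (isOpen_lt Complex.continuous_im continuous_const))

/-- `F` has a simple zero at `a`, in the sense that `F / (z - a)` has a continuous square root. -/
lemma slitFun_div_mem_slitPlane {a : ℝ} (ha : a ∈ Set.Ioo (0 : ℝ) (1 / 2)) {z : ℂ}
    (hz : z ∈ coneBox) (hza : z ≠ a) :
    slitFun a (toTorus z) / (z - a) ∈ Complex.slitPlane := by
  obtain ⟨⟨h1, h2⟩, h3, h4⟩ := hz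
  refine Complex.div_mem_slitPlane ?_
  rw [slitFun_toTorus_im, Complex.sub_im, Complex.ofReal_im, sub_zero]
  rcases lt_trichotomy z.im 0 with h | h | h
  · exact Or.inr (Or.inl ⟨Real.sin_two_pi_mul_neg h h3, h⟩)
  · refine Or.inr (Or.inr ⟨by simp [h], h, ?_⟩)
    rw [slitFun_toTorus_re, h]
    simp only [mul_zero, Real.cos_zero, sub_self, add_zero, Complex.sub_re, Complex.ofReal_re]
    rcases lt_trichotomy z.re a with h' | h' | h'
    · have := Real.cos_two_pi_mul_lt h1.le h' ha.2.le
      exact mul_pos_of_neg_of_neg (by linarith) (by linarith)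
    · exact absurd (Complex.ext h' (by simpa using h)) hza
    · have := Real.cos_two_pi_mul_lt ha.1.le h' h2.le
      exact mul_pos (by linarith) (by linarith)
  · exact Or.inl ⟨Real.sin_two_pi_mul_pos h h4, h⟩

lemma coneBox_subset {a : ℝ} (ha : a ∈ Set.Ioo (0 : ℝ) (1 / 2)) :
    coneBox ⊆ (boxChart a).source := by
  rintro z ⟨⟨h1, h2⟩, h3, h4⟩
  obtain ⟨h5, h6⟩ := ha
  rw [mem_boxChart_source, abs_lt, abs_lt]
  simp only [Complex.ofReal_re, Complex.ofReal_im]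
  refine ⟨⟨?_, ?_⟩, ?_, ?_⟩ <;> linarith

/-- Continuity at a zero of a complex function follows from continuity of the square of its
norm. -/
lemma continuousWithinAt_of_norm_sq {X : Type*} [TopologicalSpace X] {f : X → ℂ} {g : X → ℝ} {x : X}
    {s : Set X} (hf : f x = 0) (hg : ContinuousWithinAt g s x)
    (hfg : ∀ y ∈ s, ‖f y‖ ^ 2 = g y) (hx : x ∈ s) :
    ContinuousWithinAt f s x := by
  have h1 : ContinuousWithinAt (fun y => √(g y)) s x := hg.sqrt
  have h2 : √(g x) = 0 := by rw [← hfg x hx, hf]; simp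
  rw [ContinuousWithinAt, h2] at h1
  rw [ContinuousWithinAt, hf, tendsto_zero_iff_norm_tendsto_zero]
  refine h1.congr' ?_
  filter_upwards [self_mem_nhdsWithin] with y hy
  rw [← hfg y hy, Real.sqrt_sq (norm_nonneg _)]

namespace SlitTorus

variable {a : ℝ}

/-- The coordinate `√(z - a)` at the cone point over `a`, in the form `Y / √(F / (z - a))`, which
is single valued on the double cover. -/
def coneFun (s : SlitTorus a) : ℂ :=
  s.root / (slitFun a s.proj / ((boxChart a).symm s.proj - a)).sqrt

/-- The square root of `F` at `a + u²` that belongs to the value `u` of the coordinate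
`√(z - a)`. -/
def coneRoot (a : ℝ) (u : ℂ) : ℂ :=
  u * (slitFun a (toTorus (a + u ^ 2)) / u ^ 2).sqrt

lemma coneRoot_sq (u : ℂ) : coneRoot a u ^ 2 = slitFun a (toTorus (a + u ^ 2)) := by
  rcases eq_or_ne u 0 with rfl | hu
  · simp [coneRoot, slitFun_center]
  · rw [coneRoot, mul_pow, Complex.sqrt_sq, mul_div_cancel₀ _ (pow_ne_zero 2 hu)]

/-- The part of the double cover over the box around `a`. -/
def coneSource (a : ℝ) : Set (SlitTorus a) :=
  proj ⁻¹' ((boxChart a).target ∩ (boxChart a).symm ⁻¹' coneBox)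

lemma toTorus_symm_of_mem {s : SlitTorus a} (hs : s ∈ coneSource a) :
    toTorus ((boxChart a).symm s.proj) = s.proj := (boxChart a).right_inv hs.1

lemma root_eq_zero_of_symm_eq {s : SlitTorus a} (hs : s ∈ coneSource a)
    (h : (boxChart a).symm s.proj = a) : s.root = 0 := by
  have := s.root_sq
  rw [← toTorus_symm_of_mem hs, h, slitFun_center] at this
  exact pow_eq_zero_iff two_ne_zero |>.1 this

lemma slitFun_proj_div_mem (ha : a ∈ Set.Ioo (0 : ℝ) (1 / 2)) {s : SlitTorus a}
    (hs : s ∈ coneSource a) (h : (boxChart a).symm s.proj ≠ a) :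
    slitFun a s.proj / ((boxChart a).symm s.proj - a) ∈ Complex.slitPlane := by
  have := slitFun_div_mem_slitPlane ha hs.2 h
  rwa [toTorus_symm_of_mem hs] at this

lemma coneFun_sq (ha : a ∈ Set.Ioo (0 : ℝ) (1 / 2)) {s : SlitTorus a} (hs : s ∈ coneSource a) :
    coneFun s ^ 2 = (boxChart a).symm s.proj - a := by
  by_cases h : (boxChart a).symm s.proj = a
  · rw [coneFun, root_eq_zero_of_symm_eq hs h, h]
    simp
  · have h1 := Complex.slitPlane_ne_zero (slitFun_proj_div_mem ha hs h)
    have h2 : slitFun a s.proj ≠ 0 := fun h2 => h1 (by rw [h2, zero_div])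
    rw [coneFun, div_pow, Complex.sqrt_sq, root_sq, div_div_cancel₀ h2]

lemma continuousOn_coneFun (ha : a ∈ Set.Ioo (0 : ℝ) (1 / 2)) :
    ContinuousOn coneFun (coneSource a) := by
  intro s hs
  have hlift : ContinuousWithinAt (fun s : SlitTorus a => (boxChart a).symm s.proj)
      (coneSource a) s :=
    (boxChart a).continuousOn_symm.comp continuous_proj.continuousOn (fun s hs => hs.1) s hs
  by_cases h : (boxChart a).symm s.proj = a
  · have hg : ContinuousWithinAt (fun s : SlitTorus a => ‖(boxChart a).symm s.proj - (a : ℂ)‖)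
        (coneSource a) s := (hlift.sub continuousWithinAt_const).norm
    refine continuousWithinAt_of_norm_sq ?_ hg (fun y hy => ?_) hs
    · rw [coneFun, root_eq_zero_of_symm_eq hs h, zero_div]
    · rw [← norm_pow, coneFun_sq ha hy]
  · have h1 := slitFun_proj_div_mem ha hs h
    have h2 : ContinuousWithinAt (fun s : SlitTorus a => slitFun a s.proj /
        ((boxChart a).symm s.proj - a)) (coneSource a) s :=
      ((continuous_slitFun a).comp continuous_proj).continuousWithinAt.div
        (hlift.sub continuousWithinAt_const) (sub_ne_zero.2 h)
    have h3 := ContinuousAt.comp_continuousWithinAt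
      (f := fun s : SlitTorus a => slitFun a s.proj / ((boxChart a).symm s.proj - a))
      (Complex.continuousAt_sqrt (h1.imp le_of_lt id)) h2
    exact continuous_root.continuousWithinAt.div h3
      (Complex.sqrt_ne_zero (Complex.slitPlane_ne_zero h1))

lemma continuousOn_coneRoot (ha : a ∈ Set.Ioo (0 : ℝ) (1 / 2)) :
    ContinuousOn (coneRoot a) {u | (a + u ^ 2 : ℂ) ∈ coneBox} := by
  intro u hu
  rcases eq_or_ne u 0 with rfl | hu0
  · refine continuousWithinAt_of_norm_sq (g := fun u : ℂ => ‖slitFun a (toTorus (a + u ^ 2))‖) ?_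
      (Continuous.continuousWithinAt (by fun_prop)) (fun y hy => ?_) hu
    · simp [coneRoot]
    · rw [← norm_pow, coneRoot_sq]
  · have h1 := slitFun_div_mem_slitPlane ha hu (by simpa using hu0)
    rw [add_sub_cancel_left] at h1
    have h2 : ContinuousAt (fun u : ℂ => slitFun a (toTorus (a + u ^ 2)) / u ^ 2) u :=
      ContinuousAt.div (Continuous.continuousAt (by fun_prop))
        (Continuous.continuousAt (by fun_prop)) (pow_ne_zero 2 hu0)
    have h3 := ContinuousAt.comp (f := fun u : ℂ => slitFun a (toTorus (a + u ^ 2)) / u ^ 2)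
      (Complex.continuousAt_sqrt (h1.imp le_of_lt id)) h2
    exact (continuousAt_id.mul h3).continuousWithinAt

/-- The chart `√(z - a)` at the cone point over `a`. -/
def coneChart (ha : a ∈ Set.Ioo (0 : ℝ) (1 / 2)) : OpenPartialHomeomorph (SlitTorus a) ℂ where
  toFun := coneFun
  invFun u := mk' a (toTorus (a + u ^ 2)) (coneRoot a u)
  source := coneSource a
  target := {u | (a + u ^ 2 : ℂ) ∈ coneBox}
  map_source' s hs := by
    rw [Set.mem_ofPred_eq, coneFun_sq ha hs, add_sub_cancel]
    exact hs.2
  map_target' u hu := by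
    have h1 : (boxChart a).symm (toTorus (a + u ^ 2)) = a + u ^ 2 :=
      (boxChart a).left_inv (coneBox_subset ha hu)
    rw [coneSource, Set.mem_preimage, proj_mk']
    refine ⟨(boxChart a).map_source (coneBox_subset ha hu), ?_⟩
    rw [Set.mem_preimage, h1]
    exact hu
  left_inv' s hs := by
    have h1 : toTorus (a + coneFun s ^ 2) = s.proj := by
      rw [coneFun_sq ha hs, add_sub_cancel, toTorus_symm_of_mem hs]
    refine ext ((proj_mk' _ _).trans h1) ?_
    rw [root_mk' (coneRoot_sq _), coneRoot, h1, coneFun_sq ha hs]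
    by_cases h : (boxChart a).symm s.proj = a
    · rw [coneFun, root_eq_zero_of_symm_eq hs h]
      simp
    · exact div_mul_cancel₀ _ (Complex.sqrt_ne_zero
        (Complex.slitPlane_ne_zero (slitFun_proj_div_mem ha hs h)))
  right_inv' u hu := by
    have h1 : (boxChart a).symm (toTorus (a + u ^ 2)) = a + u ^ 2 :=
      (boxChart a).left_inv (coneBox_subset ha hu)
    rw [coneFun, proj_mk', root_mk' (coneRoot_sq _), h1, add_sub_cancel_left, coneRoot]
    rcases eq_or_ne u 0 with rfl | hu0
    · simp
    · refine mul_div_cancel_right₀ _ (Complex.sqrt_ne_zero (Complex.slitPlane_ne_zero ?_))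
      have := slitFun_div_mem_slitPlane ha hu (by simpa using hu0)
      rwa [add_sub_cancel_left] at this
  open_source := ((boxChart a).symm.isOpen_inter_preimage isOpen_coneBox).preimage continuous_proj
  open_target := isOpen_coneBox.preimage (by fun_prop)
  continuousOn_toFun := continuousOn_coneFun ha
  continuousOn_invFun := continuousOn_mk' (by fun_prop) (continuousOn_coneRoot ha)
    fun u _ => coneRoot_sq u

/-- The involution of the double cover over `(x, y) ↦ (-x, y)`, which exchanges the cone
points. -/
def reflect : SlitTorus a ≃ₜ SlitTorus a :=
  have key : ∀ s : SlitTorus a, s.root ^ 2 = slitFun a (-s.proj.1, s.proj.2) := fun s => by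
    rw [root_sq]
    simp [slitFun, AddCircle.toCircle_neg]
  have hinv : ∀ s : SlitTorus a, (ofRoot (-(ofRoot (-s.proj.1, s.proj.2) s.root (key s)).proj.1,
    (ofRoot (-s.proj.1, s.proj.2) s.root (key s)).proj.2)
    (ofRoot (-s.proj.1, s.proj.2) s.root (key s)).root (key _) : SlitTorus a) = s := fun s =>
      ext (Prod.ext (neg_neg s.proj.1) rfl) rfl
  have hcont : Continuous fun s : SlitTorus a => ofRoot (-s.proj.1, s.proj.2) s.root (key s) := by
    rw [isInducing_proj_root.continuous_iff]
    exact (((continuous_fst.comp continuous_proj).neg.prodMk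
      (continuous_snd.comp continuous_proj)).prodMk continuous_root)
  { toFun := fun s => ofRoot (-s.proj.1, s.proj.2) s.root (key s)
    invFun := fun s => ofRoot (-s.proj.1, s.proj.2) s.root (key s)
    left_inv := hinv
    right_inv := hinv
    continuous_toFun := hcont
    continuous_invFun := hcont }

lemma proj_reflect (s : SlitTorus a) : (reflect s).proj = (-s.proj.1, s.proj.2) := rfl

/-- The reflection `z ↦ i z̄`, a square root of `z ↦ -z̄`: it makes the chart obtained from the
antiholomorphic involution `reflect` holomorphic again. -/
def imagReflect : ℂ ≃ₜ ℂ :=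
  have h : ∀ z : ℂ, Complex.I * (starRingEnd ℂ) (Complex.I * (starRingEnd ℂ) z) = z := fun z => by
    simp [← mul_assoc]
  { toFun := fun z => Complex.I * (starRingEnd ℂ) z
    invFun := fun z => Complex.I * (starRingEnd ℂ) z
    left_inv := h
    right_inv := h
    continuous_toFun := by fun_prop
    continuous_invFun := by fun_prop }

/-- The chart `√(z + a)` at the cone point over `-a`. -/
def coneChart' (ha : a ∈ Set.Ioo (0 : ℝ) (1 / 2)) : OpenPartialHomeomorph (SlitTorus a) ℂ :=
  (reflect.transOpenPartialHomeomorph (coneChart ha)).transHomeomorph imagReflect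

lemma coneChart'_apply (ha : a ∈ Set.Ioo (0 : ℝ) (1 / 2)) (s : SlitTorus a) :
    coneChart' ha s = Complex.I * (starRingEnd ℂ) (coneChart ha (reflect s)) := rfl

lemma mem_coneChart'_source {ha : a ∈ Set.Ioo (0 : ℝ) (1 / 2)} {s : SlitTorus a} :
    s ∈ (coneChart' ha).source ↔ reflect s ∈ (coneChart ha).source := Iff.rfl

lemma toTorus_coneChart (ha : a ∈ Set.Ioo (0 : ℝ) (1 / 2)) {s : SlitTorus a}
    (hs : s ∈ (coneChart ha).source) :
    toTorus (coneChart ha s ^ 2) = s.proj + toTorus (-a) := by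
  have h : coneChart ha s ^ 2 = (boxChart a).symm s.proj - a := coneFun_sq ha hs
  rw [h, sub_eq_add_neg, map_add, toTorus_symm_of_mem hs]

lemma toTorus_neg_conj (z : ℂ) :
    toTorus (-(starRingEnd ℂ) z) = (-(toTorus z).1, (toTorus z).2) := by
  simp [toTorus_apply]

lemma toTorus_coneChart' (ha : a ∈ Set.Ioo (0 : ℝ) (1 / 2)) {s : SlitTorus a}
    (hs : s ∈ (coneChart' ha).source) :
    toTorus (coneChart' ha s ^ 2) = s.proj + toTorus a := by
  have h := toTorus_coneChart ha (mem_coneChart'_source.1 hs)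
  rw [coneChart'_apply, mul_pow, Complex.I_sq, ← map_pow, neg_one_mul, toTorus_neg_conj, h,
    proj_reflect]
  ext <;> simp [toTorus_apply, add_comm]

lemma root_eq_zero_iff_proj (ha : a ∈ Set.Ioo (0 : ℝ) (1 / 2)) (s : SlitTorus a) :
    s.root = 0 ↔ s.proj = toTorus a ∨ s.proj = toTorus (-a : ℝ) := by
  have h0 : s.root = 0 ↔ slitFun a s.proj = 0 := by
    rw [← root_sq, sq_eq_zero_iff]
  rw [h0]
  constructor
  · intro h
    obtain ⟨z, hz⟩ := toTorus_surjective s.proj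
    rw [← hz] at h ⊢
    have him : Real.sin (2 * Real.pi * z.im) = 0 := by
      rw [← slitFun_toTorus_im a, h, Complex.zero_im]
    have hre : Real.cos (2 * Real.pi * a) - Real.cos (2 * Real.pi * z.re) +
        (1 - Real.cos (2 * Real.pi * z.im)) = 0 := by
      rw [← slitFun_toTorus_re, h, Complex.zero_re]
    have hcos : -1 < Real.cos (2 * Real.pi * a) := by
      have := Real.cos_two_pi_mul_lt ha.1.le ha.2 le_rfl
      rwa [show 2 * Real.pi * (1 / 2) = Real.pi by ring, Real.cos_pi] at this
    have h1 := Real.cos_le_one (2 * Real.pi * z.re)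
    have hcy : Real.cos (2 * Real.pi * z.im) = 1 := by
      rcases Real.sin_eq_zero_iff_cos_eq.1 him with h2 | h2
      · exact h2
      · rw [h2] at hre
        linarith
    obtain ⟨n, hn⟩ := (Real.cos_eq_one_iff _).1 hcy
    have hn' : z.im = n := by
      have := Real.pi_pos
      field_simp at hn
      exact hn.symm
    rw [hcy, sub_self, add_zero, sub_eq_zero] at hre
    obtain ⟨k, hk⟩ := (Real.cos_eq_cos_iff).1 hre
    have hpi := Real.pi_ne_zero
    rcases hk with hk | hk
    · refine Or.inl (sub_eq_zero.1 ?_)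
      rw [← map_sub, toTorus_eq_zero_iff]
      refine ⟨k, n, Complex.ext ?_ ?_⟩
      · simp only [Complex.sub_re, Complex.ofReal_re]
        field_simp at hk
        linarith
      · simpa using hn'
    · refine Or.inr (sub_eq_zero.1 ?_)
      rw [← map_sub, toTorus_eq_zero_iff]
      refine ⟨k, n, Complex.ext ?_ ?_⟩
      · simp only [Complex.sub_re, Complex.ofReal_re]
        field_simp at hk
        linarith
      · simpa using hn'
  · rintro (h | h)
    · rw [h, slitFun_center]
    · rw [h, slitFun_toTorus_ofReal]
      simp

end SlitTorus

/-! ### The cone atlas and connectedness -/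

lemma exists_toTorus_eq (τ : Torus) :
    ∃ z : ℂ, toTorus z = τ ∧ |z.re| ≤ 1 / 2 ∧ |z.im| ≤ 1 / 2 := by
  obtain ⟨w, rfl⟩ := toTorus_surjective τ
  refine ⟨⟨w.re - round w.re, w.im - round w.im⟩, ?_, abs_sub_round _, abs_sub_round _⟩
  rw [← sub_eq_zero, ← map_sub, toTorus_eq_zero_iff]
  exact ⟨-round w.re, -round w.im, by apply Complex.ext <;> simp⟩

/-- A continuous square root on the closed upper half plane. On the open lower half plane it is a
square root of the conjugate. -/
def upperSqrt (w : ℂ) : ℂ := ⟨√((‖w‖ + w.re) / 2), √((‖w‖ - w.re) / 2)⟩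

lemma continuous_upperSqrt : Continuous upperSqrt := by
  unfold upperSqrt
  simp only [Complex.mk_eq_add_mul_I]
  fun_prop

lemma upperSqrt_sq (w : ℂ) : upperSqrt w ^ 2 = ⟨w.re, |w.im|⟩ := by
  have h1 : 0 ≤ (‖w‖ + w.re) / 2 := by linarith [(abs_le.1 (Complex.abs_re_le_norm w)).1]
  have h2 : 0 ≤ (‖w‖ - w.re) / 2 := by linarith [(abs_le.1 (Complex.abs_re_le_norm w)).2]
  rw [sq]
  apply Complex.ext
  · simp only [upperSqrt, Complex.mul_re]
    rw [Real.mul_self_sqrt h1, Real.mul_self_sqrt h2]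
    ring
  · simp only [upperSqrt, Complex.mul_im]
    rw [← Real.sqrt_mul h1, ← Real.sqrt_mul h2]
    have h3 : (‖w‖ + w.re) / 2 * ((‖w‖ - w.re) / 2) = (w.im / 2) ^ 2 := by
      have := Complex.sq_norm w
      rw [Complex.normSq_apply] at this
      linear_combination this / 4
    rw [mul_comm ((‖w‖ - w.re) / 2), h3, Real.sqrt_sq_eq_abs, abs_div, abs_two]
    ring

namespace SlitTorus

variable {a : ℝ}

/-- Around a regular point `z` is a coordinate. -/
lemma exists_regularChart (s : SlitTorus a) (hs : s.root ≠ 0) :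
    ∃ e : OpenPartialHomeomorph (SlitTorus a) ℂ, s ∈ e.source ∧
      (∀ x ∈ e.source, toTorus (e x) = x.proj) ∧ ∀ x ∈ e.source, x.root ≠ 0 := by
  obtain ⟨c, hc⟩ := toTorus_surjective s.proj
  have hF0 : slitFun a (toTorus c) ≠ 0 := by rw [hc, ← root_sq]; exact pow_ne_zero 2 hs
  have hcont : Continuous fun z : ℂ => slitFun a (toTorus z) / slitFun a (toTorus c) := by
    fun_prop
  set R := (boxChart c).source ∩
    (fun z : ℂ => slitFun a (toTorus z) / slitFun a (toTorus c)) ⁻¹' Complex.slitPlane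
  have hcR : c ∈ R := ⟨boxChart_self c, by
    rw [Set.mem_preimage, div_self hF0]
    exact Complex.one_mem_slitPlane⟩
  have hσ : ContinuousOn (fun z : ℂ => s.root *
      (slitFun a (toTorus z) / slitFun a (toTorus c)).sqrt) R :=
    continuousOn_const.mul (Complex.continuousOn_sqrt.comp hcont.continuousOn fun z hz => hz.2)
  have hlift : (boxChart c).symm s.proj = c := by
    rw [← hc]
    exact (boxChart c).left_inv (boxChart_self c)
  refine ⟨sectionChart c R ((boxChart c).open_source.inter
    (Complex.isOpen_slitPlane.preimage hcont)) Set.inter_subset_left _ hσ (fun z hz => ?_)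
    fun z hz => mul_ne_zero hs (Complex.sqrt_ne_zero (Complex.slitPlane_ne_zero hz.2)),
    ⟨⟨?_, ?_⟩, ?_⟩, fun x hx => toTorus_sectionChart hx,
    fun x hx => root_ne_zero_of_mem_sectionChart hx⟩
  · rw [mul_pow, Complex.sqrt_sq, root_sq, ← hc, mul_div_cancel₀ _ hF0]
  · rw [← hc]
    exact (boxChart c).map_source (boxChart_self c)
  · rw [Set.mem_preimage, hlift]
    exact hcR
  · rw [Set.mem_ofPred_eq, hlift]
    beta_reduce
    rw [div_self hF0, Complex.sqrt_one, mul_one, div_self hs]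
    simp

open Classical in
/-- The order of the translation structure: `2` (cone angle `4π`) over the ends of the slit. -/
def coneOrder (s : SlitTorus a) : ℕ := if s.root = 0 then 2 else 1

lemma one_lt_coneOrder_iff {s : SlitTorus a} : 1 < coneOrder s ↔ s.root = 0 := by
  unfold coneOrder
  split_ifs with h <;> simp [h]

lemma coneOrder_pos (s : SlitTorus a) : 0 < coneOrder s := by
  unfold coneOrder
  split_ifs <;> simp

lemma eq_of_mem_coneChart (ha : a ∈ Set.Ioo (0 : ℝ) (1 / 2)) {s : SlitTorus a}
    (hs : s ∈ (coneChart ha).source) (h0 : s.root = 0) :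
    s.proj = toTorus a ∧ coneChart ha s = 0 := by
  have h1 : coneChart ha s = 0 := by
    change s.root / _ = 0
    rw [h0, zero_div]
  refine ⟨?_, h1⟩
  have := toTorus_coneChart ha hs
  rw [h1, zero_pow two_ne_zero, map_zero, map_neg] at this
  exact (add_neg_eq_zero.1 this.symm)

lemma mem_coneChart_source_of_proj (ha : a ∈ Set.Ioo (0 : ℝ) (1 / 2)) {s : SlitTorus a}
    (h : s.proj = toTorus a) : s ∈ (coneChart ha).source := by
  have hbox : (a : ℂ) ∈ coneBox := ⟨⟨ha.1, ha.2⟩, by norm_num, by norm_num⟩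
  have hmem := coneBox_subset ha hbox
  have hlift : (boxChart a).symm (toTorus a) = a := (boxChart a).left_inv hmem
  refine ⟨?_, ?_⟩
  · rw [h]
    exact (boxChart a).map_source hmem
  · rw [Set.mem_preimage, h, hlift]
    exact hbox

lemma proj_reflect_eq {s : SlitTorus a} :
    (reflect s).proj = toTorus a ↔ s.proj = toTorus (-a : ℝ) := by
  rw [proj_reflect, Prod.ext_iff, Prod.ext_iff]
  simp only [toTorus_apply, Complex.ofReal_re, Complex.ofReal_im, AddCircle.coe_neg]
  rw [neg_eq_iff_eq_neg]

/-- Every point has a chart whose power `coneOrder s` is, up to a constant, the coordinate `z` of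
the torus. -/
lemma exists_chart (ha : a ∈ Set.Ioo (0 : ℝ) (1 / 2)) (s : SlitTorus a) :
    ∃ e : OpenPartialHomeomorph (SlitTorus a) ℂ, s ∈ e.source ∧
      (∃ τ : Torus, ∀ x ∈ e.source, toTorus (e x ^ coneOrder s) = x.proj + τ) ∧
      (∀ x ∈ e.source, x.root = 0 → x = s) ∧ (s.root = 0 → e s = 0) := by
  by_cases h0 : s.root = 0
  · have hord : coneOrder s = 2 := if_pos h0
    rw [hord]
    rcases (root_eq_zero_iff_proj ha s).1 h0 with h | h
    · have hs := mem_coneChart_source_of_proj ha h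
      exact ⟨coneChart ha, hs, ⟨_, fun x hx => toTorus_coneChart ha hx⟩, fun x hx hx0 =>
        ext ((eq_of_mem_coneChart ha hx hx0).1.trans h.symm) (hx0.trans h0.symm),
        fun _ => (eq_of_mem_coneChart ha hs h0).2⟩
    · have hs : s ∈ (coneChart' ha).source :=
        mem_coneChart'_source.2 (mem_coneChart_source_of_proj ha (proj_reflect_eq.2 h))
      refine ⟨coneChart' ha, hs, ⟨_, fun x hx => toTorus_coneChart' ha hx⟩, fun x hx hx0 =>
        ext ?_ (hx0.trans h0.symm), fun _ => ?_⟩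
      · rw [h]
        exact proj_reflect_eq.1 (eq_of_mem_coneChart ha (mem_coneChart'_source.1 hx) hx0).1
      · rw [coneChart'_apply, (eq_of_mem_coneChart ha (mem_coneChart'_source.1 hs) h0).2]
        simp
  · have hord : coneOrder s = 1 := if_neg h0
    obtain ⟨e, h1, h2, h3⟩ := exists_regularChart s h0
    refine ⟨e, h1, ⟨0, fun x hx => ?_⟩, fun x hx hx0 => absurd hx0 (h3 x hx),
      fun h => absurd h h0⟩
    rw [hord, pow_one, h2 x hx, add_zero]

/-- The cone atlas of the double cover, whose developing maps are the local lifts of `z`. -/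
def coneAtlas (ha : a ∈ Set.Ioo (0 : ℝ) (1 / 2)) : ConeAtlas (SlitTorus a) where
  chart s := (exists_chart ha s).choose
  order := coneOrder
  order_pos := coneOrder_pos
  mem_source s := (exists_chart ha s).choose_spec.1
  eq_center s x hx h := (exists_chart ha s).choose_spec.2.2.1 x hx (one_lt_coneOrder_iff.1 h)
  chart_center s h := (exists_chart ha s).choose_spec.2.2.2 (one_lt_coneOrder_iff.1 h)
  compat s s' x hx hx' := by
    obtain ⟨τ, hτ⟩ := (exists_chart ha s).choose_spec.2.1
    obtain ⟨τ', hτ'⟩ := (exists_chart ha s').choose_spec.2.1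
    refine ⟨_, eventually_eq_add_of_toTorus (τ := τ' - τ)
      (((exists_chart ha s').choose.continuousAt hx').pow _)
      (((exists_chart ha s).choose.continuousAt hx).pow _) ?_⟩
    filter_upwards [(exists_chart ha s).choose.open_source.mem_nhds hx,
      (exists_chart ha s').choose.open_source.mem_nhds hx'] with y hy hy'
    rw [hτ y hy, hτ' y hy']
    abel

lemma order_coneAtlas_le_one_iff (ha : a ∈ Set.Ioo (0 : ℝ) (1 / 2)) (s : SlitTorus a) :
    (coneAtlas ha).order s ≤ 1 ↔ s.root ≠ 0 := by
  rw [← not_lt]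
  exact not_congr one_lt_coneOrder_iff

lemma toTorus_dev (ha : a ∈ Set.Ioo (0 : ℝ) (1 / 2)) (s : SlitTorus a) :
    ∃ τ : Torus, ∀ᶠ x in 𝓝 s, toTorus ((coneAtlas ha).dev s x) = x.proj + τ := by
  obtain ⟨τ, hτ⟩ := (exists_chart ha s).choose_spec.2.1
  refine ⟨τ, ?_⟩
  filter_upwards [((coneAtlas ha).chart s).open_source.mem_nhds ((coneAtlas ha).mem_source s)]
    with x hx using hτ x hx

lemma continuousAt_dev (ha : a ∈ Set.Ioo (0 : ℝ) (1 / 2)) (s : SlitTorus a) :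
    ContinuousAt ((coneAtlas ha).dev s) s :=
  (((coneAtlas ha).chart s).continuousAt ((coneAtlas ha).mem_source s)).pow _

/-- The cone point over the end `a` of the slit. -/
def conePoint (a : ℝ) : SlitTorus a := ofRoot (toTorus a) 0 (by simp [slitFun_center])

/-- Over a connected set on which `F` has a continuous square root, every point of the double
cover is joined to the cone point, where the two sheets meet. -/
lemma exists_preconnected {s : SlitTorus a} {K : Set ℂ} (hK : IsPreconnected K)
    (haK : (a : ℂ) ∈ K)
    {σ : ℂ → ℂ} (hσ : ContinuousOn σ K) (hsq : ∀ z ∈ K, σ z ^ 2 = slitFun a (toTorus z))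
    {z : ℂ} (hz : z ∈ K) (hs : toTorus z = s.proj) :
    ∃ t : Set (SlitTorus a), conePoint a ∈ t ∧ s ∈ t ∧ IsPreconnected t := by
  have key : ∀ σ : ℂ → ℂ, ContinuousOn σ K → (∀ z ∈ K, σ z ^ 2 = slitFun a (toTorus z)) →
      s.root = σ z → ∃ t : Set (SlitTorus a), conePoint a ∈ t ∧ s ∈ t ∧ IsPreconnected t := by
    intro σ hσ hsq hroot
    refine ⟨(fun z => mk' a (toTorus z) (σ z)) '' K, ⟨a, haK, ?_⟩, ⟨z, hz, ?_⟩,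
      hK.image _ (continuousOn_mk' continuous_toTorus.continuousOn hσ hsq)⟩
    · refine ext (proj_mk' _ _) ?_
      have := hsq a haK
      rw [root_mk' this]
      rw [slitFun_center, sq_eq_zero_iff] at this
      exact this
    · exact ext ((proj_mk' _ _).trans hs) ((root_mk' (hsq z hz)).trans hroot.symm)
  have h2 : s.root ^ 2 = σ z ^ 2 := by rw [root_sq, hsq z hz, hs]
  rcases sq_eq_sq_iff_eq_or_eq_neg.1 h2 with h | h
  · exact key σ hσ hsq h
  · exact key (fun z => -σ z) hσ.neg (fun z hz => by rw [neg_sq, hsq z hz]) h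

lemma connectedSpace (ha : a ∈ Set.Ioo (0 : ℝ) (1 / 2)) : ConnectedSpace (SlitTorus a) := by
  have hpre : PreconnectedSpace (SlitTorus a) := by
    refine ⟨isPreconnected_of_forall (conePoint a) fun s _ => ?_⟩
    suffices h : ∃ t : Set (SlitTorus a), conePoint a ∈ t ∧ s ∈ t ∧ IsPreconnected t by
      obtain ⟨t, h1, h2, h3⟩ := h
      exact ⟨t, Set.subset_univ _, h1, h2, h3⟩
    obtain ⟨z, hz, hre, him⟩ := exists_toTorus_eq s.proj
    rw [abs_le] at hre him
    have hconv : ∀ c d : ℝ, IsPreconnected {z : ℂ | z.re ∈ Set.Icc (-(1 / 2)) (1 / 2) ∧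
        z.im ∈ Set.Icc c d} := fun c d =>
      (((convex_Icc (-(1 / 2) : ℝ) (1 / 2)).is_linear_preimage
        Complex.reLm.isLinear).inter ((convex_Icc c d).is_linear_preimage
        Complex.imLm.isLinear)).isPreconnected
    have hcont : Continuous fun z : ℂ => upperSqrt (slitFun a (toTorus z)) :=
      continuous_upperSqrt.comp (by fun_prop)
    have hpi := Real.pi_pos
    have ha1 := ha.1
    have ha2 := ha.2
    -- the sign of `Im F` is constant on each half of the unit square
    rcases le_total 0 z.im with h | h
    · refine exists_preconnected (hconv 0 (1 / 2)) ?_ hcont.continuousOn (fun w hw => ?_)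
        (z := z) ⟨hre, h, him.2⟩ hz
      · exact ⟨⟨by simp; linarith, by simp; linarith⟩, by simp⟩
      · rw [upperSqrt_sq, slitFun_toTorus_im, abs_of_nonneg]
        · rw [← slitFun_toTorus_im a]
        · exact Real.sin_nonneg_of_nonneg_of_le_pi (by have := hw.2.1; positivity)
            (by nlinarith [hw.2.2])
    · refine exists_preconnected (hconv (-(1 / 2)) 0) ?_
        (Complex.continuous_conj.comp hcont).continuousOn (fun w hw => ?_)
        (z := z) ⟨hre, him.1, h⟩ hz
      · exact ⟨⟨by simp; linarith, by simp; linarith⟩, by simp⟩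
      · rw [Function.comp_apply, ← map_pow, upperSqrt_sq, slitFun_toTorus_im, abs_of_nonpos]
        · rw [← slitFun_toTorus_im a]
          apply Complex.ext <;> simp
        · have h1 := hw.2.2
          have h2 := hw.2.1
          exact Real.sin_nonpos_of_nonpos_of_neg_pi_le (by nlinarith) (by nlinarith)
  exact { hpre with toNonempty := ⟨conePoint a⟩ }

lemma exists_order_le_one (ha : a ∈ Set.Ioo (0 : ℝ) (1 / 2)) :
    ∃ s, (coneAtlas ha).order s ≤ 1 := by
  refine ⟨mk' a 0 (slitFun a 0).sqrt, ?_⟩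
  rw [order_coneAtlas_le_one_iff, root_mk' (Complex.sqrt_sq _)]
  refine Complex.sqrt_ne_zero ?_
  have h1 := slitFun_toTorus_ofReal a 0
  have h2 := Real.cos_two_pi_mul_lt le_rfl ha.1 ha.2.le
  rw [Complex.ofReal_zero, map_zero] at h1
  rw [h1]
  exact_mod_cast (sub_neg.2 h2).ne

end SlitTorus

/-! ### The surfaces and their straight paths -/

/-- The composition of the shear `(x, y) ↦ (x - θ y, y)`, which makes the direction `(θ, 1)`
vertical, with the Teichmüller flow for the time `t`. -/
def shearFlow (θ t : ℝ) : ℂ ≃L[ℝ] ℂ where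
  toFun z := ⟨Real.exp (t / 2) * (z.re - θ * z.im), Real.exp (-t / 2) * z.im⟩
  invFun z := ⟨Real.exp (-t / 2) * z.re + θ * (Real.exp (t / 2) * z.im), Real.exp (t / 2) * z.im⟩
  map_add' z w := by apply Complex.ext <;> simp <;> ring
  map_smul' c z := by apply Complex.ext <;> simp <;> ring
  left_inv z := by
    have h : Real.exp (t / 2) * Real.exp (-t / 2) = 1 := by
      rw [← Real.exp_add]; ring_nf; exact Real.exp_zero
    apply Complex.ext
    · linear_combination z.re * h
    · linear_combination z.im * h
  right_inv z := by
    have h : Real.exp (t / 2) * Real.exp (-t / 2) = 1 := by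
      rw [← Real.exp_add]; ring_nf; exact Real.exp_zero
    apply Complex.ext
    · linear_combination z.re * h
    · linear_combination z.im * h
  continuous_toFun := by
    simp only [Complex.mk_eq_add_mul_I]
    fun_prop
  continuous_invFun := by
    simp only [Complex.mk_eq_add_mul_I]
    fun_prop

lemma shearFlow_apply (θ t : ℝ) (z : ℂ) : shearFlow θ t z =
    ⟨Real.exp (t / 2) * (z.re - θ * z.im), Real.exp (-t / 2) * z.im⟩ := rfl

lemma preservesRays_shearFlow (θ t : ℝ) : PreservesRays (shearFlow θ t) := by
  intro z hz
  refine Complex.div_mem_slitPlane ?_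
  have h1 := Real.exp_pos (t / 2)
  have h2 := Real.exp_pos (-t / 2)
  rw [shearFlow_apply]
  rcases lt_trichotomy z.im 0 with h | h | h
  · exact Or.inr (Or.inl ⟨mul_neg_of_pos_of_neg h2 h, h⟩)
  · refine Or.inr (Or.inr ⟨by simp [h], h, ?_⟩)
    have hre : z.re ≠ 0 := fun hre => hz (Complex.ext hre h)
    have : 0 < z.re * z.re := mul_self_pos.2 hre
    simp only [h, mul_zero, sub_zero]
    rw [mul_assoc]
    positivity
  · exact Or.inl ⟨mul_pos h2 h, h⟩

lemma teichmullerMap_shearFlow (θ t : ℝ) (z : ℂ) :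
    teichmullerMap t (shearFlow θ 0 z) = shearFlow θ t z := by
  apply Complex.ext <;> simp [shearFlow_apply, teichmullerMap]

namespace SlitTorus

variable {a : ℝ}

/-- The double cover of the slit torus, sheared so that the direction `(θ, 1)` is vertical, after
the time `t` of the Teichmüller flow. -/
def surface (ha : a ∈ Set.Ioo (0 : ℝ) (1 / 2)) (θ t : ℝ) : TranslationSurface :=
  haveI := connectedSpace ha
  ((coneAtlas ha).map (shearFlow θ t) (preservesRays_shearFlow θ t)).toTranslationSurface
    (exists_order_le_one ha)

variable {ha : a ∈ Set.Ioo (0 : ℝ) (1 / 2)} {θ t : ℝ}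

lemma isTeichmullerGeodesic_surface (ha : a ∈ Set.Ioo (0 : ℝ) (1 / 2)) (θ : ℝ) :
    IsTeichmullerGeodesic (surface ha θ) := fun t =>
  haveI := connectedSpace ha
  (coneAtlas ha).isEvolution_map (teichmullerMap_shearFlow θ t)

lemma mem_zeros_surface {s : SlitTorus a} : s ∈ (surface ha θ t).zeros ↔ s.root = 0 := by
  have := connectedSpace ha
  exact (ConeAtlas.mem_zeros_iff (A := (coneAtlas ha).map (shearFlow θ t)
    (preservesRays_shearFlow θ t)) (S := SlitTorus a) (x := s)).trans one_lt_coneOrder_iff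

lemma isNaturalParameter_surface_iff {φ : OpenPartialHomeomorph (SlitTorus a) ℂ} :
    (surface ha θ t).IsNaturalParameter φ ↔ ∀ x ∈ φ.source, x.root ≠ 0 ∧
      ∃ c : ℂ, ∀ᶠ y in 𝓝 x, φ y = shearFlow θ t ((coneAtlas ha).dev x y) + c := by
  have := connectedSpace ha
  refine (ConeAtlas.isNaturalParameter_iff (A := (coneAtlas ha).map (shearFlow θ t)
    (preservesRays_shearFlow θ t)) (S := SlitTorus a) φ).trans ?_
  refine forall₂_congr fun x _ => and_congr (order_coneAtlas_le_one_iff ha x) ?_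
  simp_rw [ConeAtlas.map_dev]

/-- Every natural parameter is, up to `shearFlow θ t` and a constant, the coordinate `z` of the
torus. -/
lemma eventually_proj_eq {φ : OpenPartialHomeomorph (SlitTorus a) ℂ}
    (hφ : (surface ha θ t).IsNaturalParameter φ) {x : SlitTorus a} (hx : x ∈ φ.source) :
    ∀ᶠ y in 𝓝 x, y.proj = x.proj + toTorus ((shearFlow θ t).symm (φ y - φ x)) := by
  obtain ⟨-, c, hc⟩ := isNaturalParameter_surface_iff.1 hφ x hx
  obtain ⟨τ, hτ⟩ := toTorus_dev ha x
  filter_upwards [hc, hτ] with y hy hy'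
  rw [hy, hc.self_of_nhds, add_sub_add_right_eq_sub, ← map_sub,
    ContinuousLinearEquiv.symm_apply_apply, map_sub, hy', hτ.self_of_nhds]
  abel

section Straight

variable {γ : ℝ → SlitTorus a} {v : ℂ} {J : Set ℝ}

lemma root_ne_zero_of_isStraightOn (h : (surface ha θ t).IsStraightOn γ v J) {s : ℝ}
    (hs : s ∈ J) :
    (γ s).root ≠ 0 := by
  obtain ⟨φ, hφ, hsφ, -⟩ := h s hs
  exact (isNaturalParameter_surface_iff.1 hφ _ hsφ).1

lemma eventually_eq_symm_of_isStraightOn (h : (surface ha θ t).IsStraightOn γ v J) {s : ℝ}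
    (hs : s ∈ J) : ∃ φ : OpenPartialHomeomorph (SlitTorus a) ℂ,
    (surface ha θ t).IsNaturalParameter φ ∧ γ s ∈ φ.source ∧
      (∀ᶠ u in 𝓝[J] s, φ (γ u) = φ (γ s) + ((u - s : ℝ) : ℂ) * v) ∧
      ∀ᶠ u in 𝓝[J] s, γ u = φ.symm (φ (γ s) + ((u - s : ℝ) : ℂ) * v) := by
  obtain ⟨φ, hφ, hsφ, hev⟩ := h s hs
  refine ⟨φ, hφ, hsφ, hev.mono fun u hu => hu.2, hev.mono fun u hu => ?_⟩
  exact (φ.left_inv hu.1).symm.trans (congrArg φ.symm hu.2)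

lemma continuousOn_of_isStraightOn (h : (surface ha θ t).IsStraightOn γ v J) :
    ContinuousOn γ J := by
  intro s hs
  obtain ⟨φ, -, hsφ, -, hev⟩ := eventually_eq_symm_of_isStraightOn h hs
  have h1 : ContinuousAt φ.symm (φ (γ s) + ((s - s : ℝ) : ℂ) * v) := by
    rw [sub_self, Complex.ofReal_zero, zero_mul, add_zero]
    exact φ.symm.continuousAt (φ.map_source hsφ)
  have h2 : ContinuousAt (fun u : ℝ => φ.symm (φ (γ s) + ((u - s : ℝ) : ℂ) * v)) s :=
    ContinuousAt.comp (f := fun u : ℝ => φ (γ s) + ((u - s : ℝ) : ℂ) * v) h1 (by fun_prop)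
  refine h2.continuousWithinAt.congr_of_eventuallyEq hev ?_
  simp [φ.left_inv hsφ]

/-- A straight path on the surface lies over a straight path on the torus. -/
lemma proj_of_isStraightOn (h : (surface ha θ t).IsStraightOn γ v J) (hJ : IsPreconnected J)
    {s u : ℝ} (hs : s ∈ J) (hu : u ∈ J) :
    (γ u).proj = (γ s).proj + toTorus ((u - s) • (shearFlow θ t).symm v) := by
  refine hJ.induction₂ (fun s u => (γ u).proj = (γ s).proj +
    toTorus ((u - s) • (shearFlow θ t).symm v)) (fun s hs => ?_) (fun x y z _ _ _ h1 h2 => ?_)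
    (fun x y _ _ h1 => ?_) hs hu
  · obtain ⟨φ, hφ, hsφ, hev, -⟩ := eventually_eq_symm_of_isStraightOn h hs
    filter_upwards [hev, (continuousOn_of_isStraightOn h s hs).eventually
      (eventually_proj_eq hφ hsφ)] with u hu hu'
    rw [hu', hu, add_sub_cancel_left, ← Complex.real_smul, map_smul]
  · rw [h2, h1, add_assoc, ← map_add, ← add_smul]
    congr 3
    ring
  · rw [h1, add_assoc, ← map_add, ← add_smul]
    simp

/-- The holonomy of a saddle connection is nonzero and comes from a lattice vector, or from a
vector that differs from `±2a` by a lattice vector. -/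
lemma isSaddleConnection_holonomy (h : (surface ha θ t).IsSaddleConnection γ v) :
    v ≠ 0 ∧ ∃ z : ℂ, v = shearFlow θ t z ∧
      (toTorus z = 0 ∨ toTorus z = toTorus (2 * a) ∨ toTorus z = -toTorus (2 * a)) := by
  obtain ⟨hcont, h0, h1, hst⟩ := h
  replace hcont : ContinuousOn γ (Set.Icc 0 1) := hcont
  have h0' := mem_zeros_surface.1 h0
  have h1' := mem_zeros_surface.1 h1
  have hcl : Set.Icc (0 : ℝ) 1 ⊆ closure (Set.Ioo 0 1) := (closure_Ioo zero_ne_one).ge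
  have hmid : (1 / 2 : ℝ) ∈ Set.Ioo (0 : ℝ) 1 := by norm_num
  have hl : (0 : ℝ) ∈ Set.Icc (0 : ℝ) 1 := by norm_num
  have hr : (1 : ℝ) ∈ Set.Icc (0 : ℝ) 1 := by norm_num
  constructor
  -- a path of velocity zero would be constant, hence would stay in a zero
  · rintro rfl
    have hconst : Set.EqOn γ (fun _ => γ (1 / 2)) (Set.Ioo 0 1) := fun u hu =>
      isPreconnected_Ioo.induction₂ (fun s u => γ u = γ s) (fun s hs => by
        obtain ⟨φ, -, hsφ, -, hev⟩ := eventually_eq_symm_of_isStraightOn hst hs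
        filter_upwards [hev] with u hu
        rw [hu, mul_zero, add_zero, φ.left_inv hsφ])
        (fun x y z _ _ _ h1 h2 => h2.trans h1) (fun x y _ _ h1 => h1.symm) hmid hu
    have := hconst.of_subset_closure hcont continuousOn_const Set.Ioo_subset_Icc_self hcl hl
    rw [this] at h0'
    exact root_ne_zero_of_isStraightOn hst hmid h0'
  · set w := (shearFlow θ t).symm v
    have hproj : Set.EqOn (fun u => (γ u).proj)
        (fun u => (γ (1 / 2)).proj + toTorus ((u - 1 / 2) • w)) (Set.Icc 0 1) :=
      Set.EqOn.of_subset_closure (s := Set.Ioo 0 1)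
        (fun u hu => proj_of_isStraightOn hst isPreconnected_Ioo hmid hu)
        (continuous_proj.comp_continuousOn hcont) (by fun_prop) Set.Ioo_subset_Icc_self hcl
    have hw : toTorus w = (γ 1).proj - (γ 0).proj := by
      have hr' := hproj hr
      have hl' := hproj hl
      beta_reduce at hr' hl'
      rw [hr', hl', add_sub_add_left_eq_sub, ← map_sub, ← sub_smul]
      norm_num
    refine ⟨w, ((shearFlow θ t).apply_symm_apply v).symm, ?_⟩
    have h2a : toTorus (2 * a) = toTorus a + toTorus a := by rw [← map_add, two_mul]
    rw [hw, h2a]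
    rcases (root_eq_zero_iff_proj ha _).1 h0' with h2 | h2 <;>
      rcases (root_eq_zero_iff_proj ha _).1 h1' with h3 | h3 <;> rw [h2, h3]
    · left; abel
    · right; right; push_cast; rw [map_neg]; abel
    · right; left; push_cast; rw [map_neg]; abel
    · left; abel

end Straight

end SlitTorus

/-! ### Choice of the slit directions -/

/-- For a coprime approximation `p / q` of `ξ / n` the linear form `ξ q - n p` is arbitrarily
small, and the sign of `(p, q)` can be chosen to make it positive. -/
lemma exists_coprime_small {ξ : ℝ} (hξ : Irrational ξ) {n : ℤ} (hn : 0 < n) {δ : ℝ} (hδ : 0 < δ) :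
    ∃ p q : ℤ, IsCoprime p q ∧ q ≠ 0 ∧ 0 < ξ * q - n * p ∧ ξ * q - n * p < δ := by
  have hn' : (0 : ℝ) < n := by exact_mod_cast hn
  obtain ⟨N, hN⟩ := exists_nat_gt (n / δ)
  obtain ⟨r, hr, -⟩ := Real.exists_rat_abs_sub_le_and_den_le (ξ / n) (n := N + 1) (by omega)
  have hden : (0 : ℝ) < r.den := by exact_mod_cast r.den_pos
  have hcast : (r : ℝ) = r.num / r.den := by exact_mod_cast (Rat.num_div_den r).symm
  have hcop : IsCoprime r.num (r.den : ℤ) := by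
    rw [Int.isCoprime_iff_gcd_eq_one]
    exact r.reduced
  have hval : ξ * r.den - n * r.num = n * r.den * (ξ / n - r) := by
    rw [hcast]
    field_simp
  have hlt : |ξ * r.den - n * r.num| < δ := by
    rw [hval, abs_mul, abs_of_pos (by positivity)]
    rw [div_lt_iff₀ hδ] at hN
    push_cast at hr
    calc n * r.den * |ξ / n - r| ≤ n * r.den * (1 / ((N + 1 + 1) * r.den)) := by gcongr
      _ = n / (N + 1 + 1) := by field_simp
      _ < δ := by
        rw [div_lt_iff₀ (by positivity)]
        nlinarith
  have hne : ξ * r.den - n * r.num ≠ 0 := by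
    intro h
    refine hξ ⟨n * r.num / r.den, ?_⟩
    push_cast
    field_simp
    linarith
  rcases lt_or_gt_of_ne hne with h | h
  · refine ⟨-r.num, -r.den, hcop.neg_neg, by simp, ?_⟩
    rw [abs_of_neg h] at hlt
    push_cast
    constructor <;> linarith
  · refine ⟨r.num, r.den, hcop, by simp, ?_⟩
    rw [abs_of_pos h] at hlt
    push_cast
    exact ⟨h, hlt⟩

/-- There are coprime vectors `(k, l)`, with `l` as large as desired, that span a parallelogram of
area about `η` with `(ξ, n)`. They are found among the vectors that complete a vector `(p, q)` of
tiny area to a basis: adding `(p, q)` preserves coprimality and moves the area in tiny steps. -/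
lemma exists_coprime_of_prescribed_area {ξ : ℝ} (hξ : Irrational ξ) {n : ℤ} (hn : 0 < n) {η : ℝ}
    (hη : 0 < η) (L : ℝ) :
    ∃ k l : ℤ, IsCoprime k l ∧ 0 < l ∧ L ≤ l ∧
      η / 2 ≤ |ξ * l - n * k| ∧ |ξ * l - n * k| ≤ η := by
  suffices h : ∃ k l : ℤ, IsCoprime k l ∧ l ≠ 0 ∧ L ≤ |(l : ℝ)| ∧
      η / 2 ≤ |ξ * l - n * k| ∧ |ξ * l - n * k| ≤ η by
    obtain ⟨k, l, h1, h2, h3, h4⟩ := h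
    rcases lt_or_gt_of_ne h2 with h | h
    · refine ⟨-k, -l, h1.neg_neg, by omega, ?_, ?_⟩
      · rw [abs_of_neg (by exact_mod_cast h)] at h3
        exact_mod_cast h3
      · push_cast
        rw [show ξ * -(l : ℝ) - n * -(k : ℝ) = -(ξ * l - n * k) by ring, abs_neg]
        exact h4
    · refine ⟨k, l, h1, h, ?_, h4⟩
      rwa [abs_of_pos (by exact_mod_cast h)] at h3
  obtain ⟨N, hN⟩ := exists_nat_gt (max L 0)
  have hNL := (le_max_left L 0).trans_lt hN
  have hN0 : (0 : ℝ) < N := (le_max_right L 0).trans_lt hN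
  obtain ⟨p, q, ⟨x, y, hxy⟩, hq, hδ0, hδ⟩ :=
    exists_coprime_small hξ hn (δ := η / 2 / (2 * N + 1)) (by positivity)
  set δ := ξ * q - n * p with hδdef
  rw [lt_div_iff₀ (by positivity)] at hδ
  -- `(p', q') = (-y, x)` completes `(p, q)` to a basis
  set c : ℝ := ξ * x - n * (-y) with hc
  set b : ℤ := ⌈(η / 2 - c) / δ⌉ with hb
  have hb1 : η / 2 ≤ c + b * δ := by
    have := Int.le_ceil ((η / 2 - c) / δ)
    rw [div_le_iff₀ hδ0] at this
    linarith
  have hb2 : c + b * δ ≤ η / 2 + δ := by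
    have := (Int.ceil_lt_add_one ((η / 2 - c) / δ)).le
    rw [← hb, ← sub_le_iff_le_add, le_div_iff₀ hδ0] at this
    linarith
  have key : ∀ i : ℤ, c + i * δ = ξ * ((x + i * q : ℤ) : ℝ) - n * ((-y + i * p : ℤ) : ℝ) := by
    intro i
    push_cast
    rw [hc, hδdef]
    ring
  have hcop : ∀ i : ℤ, IsCoprime (-y + i * p) (x + i * q) := fun i =>
    ⟨-q, p, by linear_combination hxy⟩
  have hfin : ∀ i : ℤ, (N : ℝ) ≤ |((x + i * q : ℤ) : ℝ)| → η / 2 ≤ c + i * δ →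
      c + i * δ ≤ η → ∃ k l : ℤ, IsCoprime k l ∧ l ≠ 0 ∧ L ≤ |(l : ℝ)| ∧
      η / 2 ≤ |ξ * l - n * k| ∧ |ξ * l - n * k| ≤ η := by
    intro i h1 h2 h3
    refine ⟨_, _, hcop i, ?_, hNL.le.trans h1, ?_⟩
    · intro h
      rw [h, Int.cast_zero, abs_zero] at h1
      linarith
    · rw [← key, abs_of_nonneg (by linarith)]
      exact ⟨h2, h3⟩
  -- if `x + b q` is too small, then `2 N` more steps make it large, and they change the area by
  -- less than `η / 2`
  by_cases hcase : (N : ℝ) ≤ |((x + b * q : ℤ) : ℝ)|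
  · refine hfin b hcase hb1 ?_
    nlinarith
  · refine hfin (b + 2 * N) ?_ ?_ ?_
    · have hq1 : (1 : ℝ) ≤ |(q : ℝ)| := by exact_mod_cast Int.one_le_abs hq
      have h1 : |2 * (N : ℝ) * q| ≤ |((x + (b + 2 * N) * q : ℤ) : ℝ)| +
          |((x + b * q : ℤ) : ℝ)| := by
        refine le_trans (le_of_eq ?_) (abs_sub _ _)
        push_cast
        ring_nf
      rw [abs_mul, abs_of_pos (by positivity : (0 : ℝ) < 2 * N)] at h1
      push_cast at h1 hcase ⊢
      nlinarith
    · push_cast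
      nlinarith
    · push_cast
      nlinarith

/-- The recursive choice of the vectors `v_j = (k_j, l_j)`. The vector `v₀ = (0, 1)` makes the
vertical component of `w_j` positive for `j ≥ 1`. -/
lemma exists_slit_sequence {α : ℝ} (hα : Irrational α) (L : ℕ → ℝ) :
    ∃ k l : ℕ → ℤ, l 0 = 1 ∧ (∀ j, 0 < l j) ∧ ∀ j, 1 ≤ j →
      IsCoprime (k j) (l j) ∧ L j ≤ l j ∧
      (1 / 4 : ℝ) ^ j / 2 ≤ |(α + 2 * ∑ i ∈ Finset.range j, (k i : ℝ)) * l j -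
        2 * (∑ i ∈ Finset.range j, (l i : ℝ)) * k j| ∧
      |(α + 2 * ∑ i ∈ Finset.range j, (k i : ℝ)) * l j -
        2 * (∑ i ∈ Finset.range j, (l i : ℝ)) * k j| ≤ (1 / 4 : ℝ) ^ j := by
  have step : ∀ (j : ℕ) (p : {p : ℤ × ℤ // 0 < p.2}), ∃ v : ℤ × ℤ, IsCoprime v.1 v.2 ∧ 0 < v.2 ∧
      L j ≤ v.2 ∧ (1 / 4 : ℝ) ^ j / 2 ≤ |(α + 2 * p.1.1) * v.2 - 2 * p.1.2 * v.1| ∧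
      |(α + 2 * p.1.1) * v.2 - 2 * p.1.2 * v.1| ≤ (1 / 4 : ℝ) ^ j := by
    rintro j ⟨⟨M, N⟩, hN⟩
    have hirr : Irrational (α + 2 * M) := by
      have := hα.add_intCast (2 * M)
      push_cast at this
      exact this
    obtain ⟨k, l, h1, h2, h3, h4, h5⟩ := exists_coprime_of_prescribed_area hirr
      (n := 2 * N) (by dsimp only at hN; omega) (η := (1 / 4 : ℝ) ^ j) (by positivity) (L j)
    push_cast at h4 h5
    exact ⟨(k, l), h1, h2, h3, h4, h5⟩
  choose V hV using step
  -- `w_{j + 1}` equals `(α, 0) + 2 (st j).1`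
  let st : ℕ → {p : ℤ × ℤ // 0 < p.2} := fun j => Nat.rec ⟨(0, 1), one_pos⟩
    (fun j p => ⟨p.1 + V (j + 1) p, add_pos p.2 (hV (j + 1) p).2.1⟩) j
  have hst0 : (st 0).1 = (0, 1) := rfl
  have hst : ∀ j, (st (j + 1)).1 = (st j).1 + V (j + 1) (st j) := fun j => rfl
  let v : ℕ → ℤ × ℤ := fun j => Nat.casesOn j (0, 1) fun j => V (j + 1) (st j)
  have hv : ∀ j, v (j + 1) = V (j + 1) (st j) := fun j => rfl
  have hsum : ∀ j, ∑ i ∈ Finset.range (j + 1), v i = (st j).1 := by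
    intro j
    induction j with
    | zero => simp [hst0, v]
    | succ j ih => rw [Finset.sum_range_succ, ih, hst, hv]
  refine ⟨fun j => (v j).1, fun j => (v j).2, rfl, fun j => ?_, fun j hj => ?_⟩
  · cases j with
    | zero => exact one_pos
    | succ j => exact (hV (j + 1) (st j)).2.1
  · obtain ⟨j, rfl⟩ := Nat.exists_eq_add_of_le' hj
    have h1 : ∑ i ∈ Finset.range (j + 1), ((v i).1 : ℝ) = ((st j).1.1 : ℝ) := by
      rw [← hsum j, Prod.fst_sum]
      push_cast
      rfl
    have h2 : ∑ i ∈ Finset.range (j + 1), ((v i).2 : ℝ) = ((st j).1.2 : ℝ) := by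
      rw [← hsum j, Prod.snd_sum]
      push_cast
      rfl
    rw [h1, h2]
    obtain ⟨h3, -, h4, h5, h6⟩ := hV (j + 1) (st j)
    exact ⟨h3, h4, h5, h6⟩

/-- The slopes `M_j / N_j` of the vectors `w_j = (M_j, N_j)` converge to a slope `θ`, because
consecutive ones differ by `2 |w_j × v_j| / (N_j N_{j+1})`; this also bounds the transverse
components of `w_j` and `v_j`. -/
lemma exists_slit_directions {α : ℝ} (hα : Irrational α) (L : ℕ → ℝ) :
    ∃ (k l : ℕ → ℤ) (θ : ℝ), (∀ j, 0 < l j) ∧ ∀ j, 1 ≤ j →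
      IsCoprime (k j) (l j) ∧ L j ≤ l j ∧
      (1 / 4 : ℝ) ^ j / 2 ≤ |(α + 2 * ∑ i ∈ Finset.range j, (k i : ℝ)) * l j -
        2 * (∑ i ∈ Finset.range j, (l i : ℝ)) * k j| ∧
      |(α + 2 * ∑ i ∈ Finset.range j, (k i : ℝ)) * l j -
        2 * (∑ i ∈ Finset.range j, (l i : ℝ)) * k j| ≤ (1 / 4 : ℝ) ^ j ∧
      |α + 2 * ∑ i ∈ Finset.range j, (k i - l i * θ)| ≤ 4 * (1 / 4 : ℝ) ^ j ∧
      l j * |k j - l j * θ| ≤ 2 * (1 / 4 : ℝ) ^ j := by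
  obtain ⟨k, l, hl0, hl, H⟩ := exists_slit_sequence hα L
  set M : ℕ → ℝ := fun j => α + 2 * ∑ i ∈ Finset.range j, (k i : ℝ) with hM
  set N : ℕ → ℝ := fun j => 2 * ∑ i ∈ Finset.range j, (l i : ℝ) with hN
  set η : ℕ → ℝ := fun j => (1 / 4 : ℝ) ^ j with hη
  have hη0 : ∀ j, 0 < η j := fun j => by positivity
  have hMs : ∀ j, M (j + 1) = M j + 2 * k j := fun j => by
    simp only [hM, Finset.sum_range_succ]; ring
  have hNs : ∀ j, N (j + 1) = N j + 2 * l j := fun j => by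
    simp only [hN, Finset.sum_range_succ]; ring
  have hl1 : ∀ j, (1 : ℝ) ≤ l j := fun j => by exact_mod_cast hl j
  have hNmono : Monotone N := monotone_nat_of_le_succ fun j => by rw [hNs]; linarith [hl1 j]
  have hN2 : ∀ j, 1 ≤ j → 2 ≤ N j := fun j hj => by
    refine le_trans (le_of_eq ?_) (hNmono hj)
    simp [hN, hl0]
  have hδ : ∀ j, 1 ≤ j → |M j * l j - N j * k j| ≤ η j := fun j hj => (H j hj).2.2.2
  set σ : ℕ → ℝ := fun j => M j / N j with hσ
  have hdist : ∀ j, 1 ≤ j → ∀ i, dist (σ (j + i)) (σ (j + (i + 1))) ≤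
      2 * η j / (N j * N (j + 1)) * (1 / 4 : ℝ) ^ i := by
    intro j hj i
    have h1 := hN2 j hj
    have h2 := hN2 (j + 1) (by omega)
    have h3 : N j ≤ N (j + i) := hNmono (by omega)
    have h4 : N (j + 1) ≤ N (j + i + 1) := hNmono (by omega)
    have h5 : σ (j + i) - σ (j + (i + 1)) =
        2 * (M (j + i) * l (j + i) - N (j + i) * k (j + i)) / (N (j + i) * N (j + i + 1)) := by
      have : N (j + i) ≠ 0 := by linarith
      have : N (j + i + 1) ≠ 0 := by linarith
      simp only [hσ, ← add_assoc]
      field_simp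
      rw [hMs, hNs]
      ring
    rw [Real.dist_eq, h5, abs_div, abs_mul, abs_two,
      abs_of_pos (mul_pos (by linarith) (by linarith) : 0 < N (j + i) * N (j + i + 1))]
    have h6 : 2 * η j / (N j * N (j + 1)) * (1 / 4 : ℝ) ^ i =
        2 * η (j + i) / (N j * N (j + 1)) := by
      simp only [hη, pow_add]
      ring
    rw [h6]
    have := hδ (j + i) (by omega)
    have := (hη0 (j + i)).le
    have : 0 ≤ N (j + i) := by linarith
    gcongr
  obtain ⟨θ, hθ⟩ : ∃ θ, Tendsto (fun i => σ (1 + i)) atTop (𝓝 θ) :=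
    cauchySeq_tendsto_of_complete
      (cauchySeq_of_le_geometric (1 / 4) _ (by norm_num) (hdist 1 le_rfl))
  have hθ' : Tendsto σ atTop (𝓝 θ) := by
    simp_rw [add_comm 1] at hθ
    exact (tendsto_add_atTop_iff_nat 1).1 hθ
  have hclose : ∀ j, 1 ≤ j → |M j - N j * θ| ≤ 4 * η j / N (j + 1) := by
    intro j hj
    have h1 := hN2 j hj
    have h2 := hN2 (j + 1) (by omega)
    have hlim : Tendsto (fun i => σ (j + i)) atTop (𝓝 θ) := by
      simp_rw [add_comm j]
      exact (tendsto_add_atTop_iff_nat j).2 hθ'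
    have h3 := dist_le_of_le_geometric_of_tendsto₀ (1 / 4) _ (by norm_num) (hdist j hj) hlim
    rw [add_zero, Real.dist_eq] at h3
    have h4 : M j - N j * θ = N j * (σ j - θ) := by
      simp only [hσ]
      field_simp
    have h5 := hη0 j
    rw [h4, abs_mul, abs_of_pos (by linarith)]
    calc N j * |σ j - θ| ≤ N j * (2 * η j / (N j * N (j + 1)) / (1 - 1 / 4)) := by gcongr
      _ = (8 / 3) * η j / N (j + 1) := by field_simp; norm_num
      _ ≤ 4 * η j / N (j + 1) := by gcongr; norm_num
  refine ⟨k, l, θ, hl, fun j hj => ⟨(H j hj).1, (H j hj).2.1, (H j hj).2.2.1,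
    (H j hj).2.2.2, ?_, ?_⟩⟩
  · have h1 : α + 2 * ∑ i ∈ Finset.range j, (k i - l i * θ) = M j - N j * θ := by
      rw [Finset.sum_sub_distrib, ← Finset.sum_mul]
      simp only [hM, hN]
      ring
    rw [h1]
    refine (hclose j hj).trans (div_le_self (by have := hη0 j; positivity) ?_)
    linarith [hN2 (j + 1) (by omega)]
  · have h1 : (k j - l j * θ : ℝ) =
        ((M (j + 1) - N (j + 1) * θ) - (M j - N j * θ)) / 2 := by
      rw [hMs, hNs]
      ring
    have h2 := hclose j hj
    have h3 := hclose (j + 1) (by omega)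
    have h4 := hN2 (j + 1) (by omega)
    have h5 : 4 * η (j + 1) / N (j + 1 + 1) ≤ 4 * η j / N (j + 1) := by
      have : η (j + 1) ≤ η j := pow_le_pow_of_le_one (by norm_num) (by norm_num) (by omega)
      have := hNmono (Nat.le_succ (j + 1))
      have := (hη0 j).le
      gcongr
    have h6 : |(k j - l j * θ : ℝ)| ≤ 4 * η j / N (j + 1) := by
      rw [h1, abs_div, abs_two]
      have := abs_sub (M (j + 1) - N (j + 1) * θ) (M j - N j * θ)
      linarith
    have h7 : (l j : ℝ) ≤ N (j + 1) / 2 := by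
      have h8 : 0 ≤ N j := by linarith [hN2 j hj]
      rw [hNs]
      linarith
    have h9 := hη0 j
    calc l j * |(k j - l j * θ : ℝ)| ≤ N (j + 1) / 2 * (4 * η j / N (j + 1)) := by gcongr
      _ = 2 * η j := by field_simp; norm_num

/-! ### Bounds for saddle connections -/

lemma TranslationSurface.logSystole_le {X : TranslationSurface} {c : ℝ} (hc : 0 < c)
    (h : ∀ γ v, X.IsSaddleConnection γ v → c ≤ ‖v‖) :
    X.logSystole ≤ ((-2 * Real.log c : ℝ) : EReal) := by
  have h1 : ENNReal.ofReal c ≤ X.shortest :=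
    le_iInf fun γ => le_iInf fun v => le_iInf fun hv => ENNReal.ofReal_le_ofReal (h γ v hv)
  have h2 := ENNReal.log_le_log h1
  rw [ENNReal.log_ofReal_of_pos hc] at h2
  rw [logSystole, EReal.coe_mul, mul_comm, mul_comm ((-2 : ℝ) : EReal)]
  exact EReal.mul_le_mul_of_nonpos_right h2 (by exact_mod_cast (by norm_num : (-2 : ℝ) ≤ 0))

lemma liminf_logSystole_div_lt_one {X : ℝ → TranslationSurface} {r : ℝ → ℝ} {τ : ℕ → ℝ}
    {D : ℕ → ℝ} (hτ : Tendsto τ atTop atTop) (hr : ∀ᶠ j in atTop, 0 < r (τ j))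
    (hD : ∀ᶠ j in atTop, (X (τ j)).logSystole ≤ (D j : EReal))
    (hDr : ∀ᶠ j in atTop, 2 * D j ≤ r (τ j)) :
    liminf (fun t : ℝ => (X t).logSystole / ((r t : ℝ) : EReal)) atTop < 1 := by
  have hev : ∀ᶠ j in atTop, (X (τ j)).logSystole / ((r (τ j) : ℝ) : EReal) ≤
      ((1 / 2 : ℝ) : EReal) := by
    filter_upwards [hr, hD, hDr] with j h1 h2 h3
    refine (EReal.div_le_div_right_of_nonneg (by exact_mod_cast h1.le) h2).trans ?_
    rw [← EReal.coe_div]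
    exact_mod_cast (by rw [div_le_iff₀ h1]; linarith)
  refine lt_of_le_of_lt (liminf_le_of_frequently_le (hτ.frequently hev.frequently)) ?_
  exact_mod_cast (by norm_num : (1 / 2 : ℝ) < 1)

lemma abs_cross_le (z w : ℂ) : |z.re * w.im - z.im * w.re| ≤ ‖z‖ * ‖w‖ := by
  have h := Complex.abs_im_le_norm ((starRingEnd ℂ) z * w)
  rw [norm_mul, Complex.norm_conj] at h
  refine le_trans (le_of_eq ?_) h
  congr 1
  simp
  ring

/-- The shear and the Teichmüller flow preserve areas. -/
lemma cross_shearFlow (θ t : ℝ) (z w : ℂ) :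
    (shearFlow θ t z).re * (shearFlow θ t w).im - (shearFlow θ t z).im * (shearFlow θ t w).re =
      z.re * w.im - z.im * w.re := by
  have h : Real.exp (t / 2) * Real.exp (-t / 2) = 1 := by
    rw [← Real.exp_add]; ring_nf; exact Real.exp_zero
  simp only [shearFlow_apply]
  linear_combination (z.re * w.im - z.im * w.re) * h

lemma le_norm_of_cross {θ t ε : ℝ} {w z : ℂ} (hw : ‖shearFlow θ t w‖ ≤ 2)
    (h : ε ≤ |z.re * w.im - z.im * w.re|) : ε / 2 ≤ ‖shearFlow θ t z‖ := by
  have h1 := abs_cross_le (shearFlow θ t z) (shearFlow θ t w)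
  rw [cross_shearFlow] at h1
  nlinarith [norm_nonneg (shearFlow θ t z)]

namespace SlitTorus

variable {a : ℝ}

/-- At the time `t` with `e ^ (t / 2) = l` the vector `(k, l)` has length at most `2`, so that a
vector whose cross product with `(k, l)` is at least `ε` has length at least `ε / 2`. The cross
product vanishes only for multiples of `(k, l)`. For the other vectors it is an integer, or
differs from `± ((2a + m) l - n k)` by an integer. -/
lemma le_norm_of_isSaddleConnection {ha : a ∈ Set.Ioo (0 : ℝ) (1 / 2)} {θ ε : ℝ} {k l m n : ℤ}
    (hkl : IsCoprime k l) (hl : 0 < l) (hθ : l * |k - l * θ| ≤ 1)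
    (hε : 0 < ε) (h1 : ε ≤ |(2 * a + m) * l - n * k|) (h2 : |(2 * a + m) * l - n * k| ≤ 1 / 4)
    (γ : ℝ → SlitTorus a) (v : ℂ)
    (h : (surface ha θ (2 * Real.log l)).IsSaddleConnection γ v) : ε / 2 ≤ ‖v‖ := by
  have hl0 : (0 : ℝ) < l := by exact_mod_cast hl
  obtain ⟨hv, z, rfl, hz⟩ := isSaddleConnection_holonomy h
  set t := 2 * Real.log l with ht
  have het : Real.exp (t / 2) = l := by
    rw [ht, mul_div_cancel_left₀ _ two_ne_zero, Real.exp_log hl0]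
  have het' : Real.exp (-t / 2) = (l : ℝ)⁻¹ := by rw [neg_div, Real.exp_neg, het]
  set w : ℂ := ⟨k, l⟩ with hw
  have hw2 : ‖shearFlow θ t w‖ ≤ 2 := by
    refine (Complex.norm_le_abs_re_add_abs_im _).trans ?_
    simp only [shearFlow_apply, het, het', hw]
    rw [abs_mul, abs_of_pos hl0, inv_mul_cancel₀ hl0.ne', abs_one, mul_comm θ]
    linarith
  have hε4 : ε ≤ 1 / 4 := h1.trans h2
  rcases hz with hz | hz
  -- a lattice vector
  · obtain ⟨m', n', rfl⟩ := toTorus_eq_zero_iff.1 hz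
    by_cases hc : m' * l - n' * k = 0
    -- a nonzero multiple of `(k, l)`, of vertical component at least `1`
    · have hdvd : l ∣ n' := by
        refine hkl.symm.dvd_of_dvd_mul_right (Dvd.intro_left m' ?_)
        linarith
      have hn0 : n' ≠ 0 := by
        rintro rfl
        have hm : m' = 0 := by simpa [hl.ne'] using hc
        subst hm
        exact hv (by
          rw [show (⟨((0 : ℤ) : ℝ), ((0 : ℤ) : ℝ)⟩ : ℂ) = 0 by apply Complex.ext <;> simp,
            map_zero])
      have hle : l ≤ |n'| := Int.le_of_dvd (abs_pos.2 hn0) ((dvd_abs _ _).2 hdvd)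
      have hle' : (l : ℝ) ≤ |(n' : ℝ)| := by exact_mod_cast hle
      have him := Complex.abs_im_le_norm (shearFlow θ t ⟨m', n'⟩)
      have him' : (shearFlow θ t ⟨m', n'⟩).im = (l : ℝ)⁻¹ * n' := by
        rw [← het']
        rfl
      rw [him', abs_mul, abs_of_pos (inv_pos.2 hl0)] at him
      have : 1 ≤ (l : ℝ)⁻¹ * |(n' : ℝ)| := by
        rw [inv_mul_eq_div, le_div_iff₀ hl0]
        linarith
      exact le_trans (by linarith) (this.trans him)
    · refine le_norm_of_cross hw2 (hε4.trans ?_)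
      have : (1 : ℝ) ≤ |((m' * l - n' * k : ℤ) : ℝ)| := by exact_mod_cast Int.one_le_abs hc
      push_cast at this
      simp only [hw]
      linarith
  · have key : ∀ σ : ℝ, (σ = 1 ∨ σ = -1) → ∀ m' n' : ℤ, z = ⟨σ * (2 * a) + m', n'⟩ →
        ε / 2 ≤ ‖shearFlow θ t z‖ := by
      rintro σ hσ m' n' rfl
      refine le_norm_of_cross hw2 ?_
      obtain ⟨s, rfl⟩ : ∃ s : ℤ, σ = s := by
        rcases hσ with rfl | rfl
        · exact ⟨1, by simp⟩
        · exact ⟨-1, by simp⟩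
      have hs : |(s : ℝ)| = 1 := by rcases hσ with h | h <;> rw [h] <;> simp
      set q : ℤ := m' * l - n' * k - s * (m * l - n * k) with hq
      have heq : ((s : ℝ) * (2 * a) + m') * l - n' * k =
          s * ((2 * a + m) * l - n * k) + q := by
        rw [hq]
        push_cast
        ring
      simp only [hw]
      rw [heq]
      by_cases hq0 : q = 0
      · rw [hq0, Int.cast_zero, add_zero, abs_mul, hs, one_mul]
        exact h1
      · have hq1 : (1 : ℝ) ≤ |(q : ℝ)| := by exact_mod_cast Int.one_le_abs hq0
        have h3 := abs_sub_abs_le_abs_add (q : ℝ) (s * ((2 * a + m) * l - n * k))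
        rw [abs_mul, hs, one_mul, add_comm (q : ℝ)] at h3
        linarith
    rcases hz with hz | hz
    · rw [← sub_eq_zero, ← map_sub, toTorus_eq_zero_iff] at hz
      obtain ⟨m', n', hz⟩ := hz
      refine key 1 (Or.inl rfl) m' n' ?_
      rw [Complex.ext_iff] at hz ⊢
      simp at hz ⊢
      constructor <;> linarith
    · rw [← sub_eq_zero, sub_neg_eq_add, ← map_add, toTorus_eq_zero_iff] at hz
      obtain ⟨m', n', hz⟩ := hz
      refine key (-1) (Or.inr rfl) m' n' ?_
      rw [Complex.ext_iff] at hz ⊢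
      simp at hz ⊢
      constructor <;> linarith

end SlitTorus

/-! ### The mod 2 cocycle over a rotation -/

lemma measurableSet_eventually_atTop {X : Type*} [MeasurableSpace X] {s : ℕ → Set X}
    (hs : ∀ j, MeasurableSet (s j)) : MeasurableSet {x | ∀ᶠ j in atTop, x ∈ s j} := by
  have h : {x | ∀ᶠ j in atTop, x ∈ s j} = ⋃ J, ⋂ j ≥ J, s j := by
    ext x
    simp [eventually_atTop]
  rw [h]
  exact MeasurableSet.iUnion fun J => MeasurableSet.biInter (Set.to_countable _) fun j _ => hs j

lemma measurableSet_frequently_atTop {X : Type*} [MeasurableSpace X] {s : ℕ → Set X}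
    (hs : ∀ j, MeasurableSet (s j)) : MeasurableSet {x | ∃ᶠ j in atTop, x ∈ s j} := by
  simpa only [Set.compl_ofPred, Filter.Frequently, Set.mem_compl_iff] using
    (measurableSet_eventually_atTop fun j => (hs j).compl).compl

/-- The signed number of integers in `(x - β, x]`, that is the `ℤ`-valued cocycle of the arc
`[0, β)` of the circle (with multiplicity and sign). Its parity tells whether the sheets are
exchanged above `x` by a slit of transverse component `β`. -/
def floorCount (β x : ℝ) : ℤ := ⌊x⌋ - ⌊x - β⌋

lemma floorCount_add (β γ x : ℝ) :
    floorCount (β + γ) x = floorCount β x + floorCount γ (x - β) := by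
  rw [floorCount, floorCount, floorCount, sub_sub]
  ring

lemma floorCount_add_intCast (β x : ℝ) (m : ℤ) : floorCount β (x + m) = floorCount β x := by
  rw [floorCount, floorCount, add_sub_right_comm, Int.floor_add_intCast, Int.floor_add_intCast]
  ring

/-- `floorCount β` is supported in the arc of radius `|β|`. -/
lemma norm_coe_le_of_floorCount_ne_zero {β x : ℝ} (h : floorCount β x ≠ 0) :
    ‖(x : UnitAddCircle)‖ ≤ |β| := by
  suffices h : ∃ N : ℤ, |x - N| ≤ |β| by
    obtain ⟨N, hN⟩ := h
    rw [UnitAddCircle.norm_eq]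
    exact (round_le x N).trans hN
  have h1 := Int.floor_le x
  have h2 := Int.floor_le (x - β)
  have h3 := Int.lt_floor_add_one x
  have h4 := Int.lt_floor_add_one (x - β)
  rcases lt_or_gt_of_ne (sub_ne_zero.1 h) with h | h
  · have h5 : (⌊x⌋ : ℝ) + 1 ≤ ⌊x - β⌋ := by exact_mod_cast h
    refine ⟨⌊x - β⌋, ?_⟩
    rw [abs_of_nonpos (by linarith : x - ⌊x - β⌋ ≤ 0), abs_of_neg (by linarith : β < 0)]
    linarith
  · have h5 : (⌊x - β⌋ : ℝ) + 1 ≤ ⌊x⌋ := by exact_mod_cast h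
    refine ⟨⌊x⌋, ?_⟩
    rw [abs_of_nonneg (by linarith : 0 ≤ x - ⌊x⌋), abs_of_pos (by linarith : 0 < β)]
    linarith

lemma measurable_floorCount (β : ℝ) : Measurable (floorCount β) := by
  unfold floorCount
  fun_prop

/-- The transfer function for the change of a slit of transverse component `α` to one of
transverse component `α + 2β`, where `β = k - l θ`. -/
def transferStep (θ α β : ℝ) (l : ℕ) (x : ℝ) : ℤ :=
  ∑ s ∈ Finset.range l, floorCount β (x - α + (s + 1 : ℕ) * θ)

/-- A telescoping sum. -/
lemma transferStep_sub (θ α β : ℝ) (l : ℕ) (x : ℝ) :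
    transferStep θ α β l (x - θ) - transferStep θ α β l x =
      floorCount β (x - α) - floorCount β (x - α + l * θ) := by
  rw [transferStep, transferStep]
  induction l with
  | zero => simp
  | succ l ih =>
    rw [Finset.sum_range_succ, Finset.sum_range_succ]
    have h : x - θ - α + (l + 1 : ℕ) * θ = x - α + l * θ := by push_cast; ring
    rw [h]
    linear_combination ih

/-- Changing a slit by twice a lattice vector `(k, l)` changes its cocycle by a coboundary mod 2:
the two copies of the arc of length `k - l θ` differ by the rotation by `l θ`. -/
lemma even_floorCount_step (θ α : ℝ) (k : ℤ) (l : ℕ) (x : ℝ) :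
    Even (floorCount (α + 2 * (k - l * θ)) x - floorCount α x -
      (transferStep θ α (k - l * θ) l (x - θ) - transferStep θ α (k - l * θ) l x)) := by
  set β : ℝ := k - l * θ with hβ
  rw [floorCount_add, two_mul, floorCount_add, transferStep_sub]
  have h : x - α - β = x - α + l * θ + (-k : ℤ) := by
    rw [hβ]
    push_cast
    ring
  rw [h, floorCount_add_intCast]
  exact ⟨floorCount β (x - α + l * θ), by ring⟩

lemma AddCircle.preimage_null {s : Set UnitAddCircle} (hs : volume s = 0) :
    volume {x : ℝ | (x : UnitAddCircle) ∈ s} = 0 := by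
  have h1 : {x : ℝ | (x : UnitAddCircle) ∈ s} =
      ⋃ n : ℤ, {x : ℝ | (x : UnitAddCircle) ∈ s} ∩ Set.Ioc (n : ℝ) (n + 1) := by
    rw [← Set.inter_iUnion, iUnion_Ioc_intCast, Set.inter_univ]
  rw [h1]
  refine measure_iUnion_null fun n => ?_
  have h2 := (AddCircle.measurePreserving_mk (1 : ℝ) n).quasiMeasurePreserving.preimage_null hs
  rwa [Measure.restrict_apply' measurableSet_Ioc] at h2

section Transfer

variable (θ α : ℝ) (k : ℕ → ℤ) (l : ℕ → ℕ)

/-- The transverse component of the `j`-th slit. -/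
def slitOffset (j : ℕ) : ℝ := α + 2 * ∑ i ∈ Finset.range j, (k i - l i * θ)

/-- The transfer function for the change of the original slit to the `j`-th slit. -/
def transferSum (j : ℕ) (x : ℝ) : ℤ :=
  ∑ i ∈ Finset.range j, transferStep θ (slitOffset θ α k l i) (k i - l i * θ) (l i) x

/-- The cocycle of the original slit is cohomologous mod 2 to the cocycle of the `j`-th slit. -/
lemma even_floorCount_transferSum (j : ℕ) (x : ℝ) :
    Even (floorCount α x - floorCount (slitOffset θ α k l j) x +
      (transferSum θ α k l j (x - θ) - transferSum θ α k l j x)) := by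
  induction j with
  | zero => simp [slitOffset, transferSum]
  | succ j ih =>
    have h := even_floorCount_step θ (slitOffset θ α k l j) (k j) (l j) x
    have h1 : slitOffset θ α k l (j + 1) = slitOffset θ α k l j + 2 * (k j - l j * θ) := by
      rw [slitOffset, slitOffset, Finset.sum_range_succ]
      ring
    rw [h1]
    have h2 (y : ℝ) : transferSum θ α k l (j + 1) y = transferSum θ α k l j y +
        transferStep θ (slitOffset θ α k l j) (k j - l j * θ) (l j) y :=
      Finset.sum_range_succ _ _
    rw [h2, h2]
    rw [Int.even_iff] at *
    omega

/-- A union of arcs that contains the points where the cocycle of the `j`-th slit or the `j`-th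
transfer step does not vanish. -/
def slitNeighbourhood (j : ℕ) : Set UnitAddCircle :=
  Metric.closedBall 0 |slitOffset θ α k l j| ∪ ⋃ s ∈ Finset.range (l j),
    Metric.closedBall (((slitOffset θ α k l j - (s + 1 : ℕ) * θ : ℝ)) : UnitAddCircle)
      |k j - l j * θ|

/-- The rotation orbits of the points that lie in infinitely many of the sets
`slitNeighbourhood j`; a null set by Borel–Cantelli. -/
def badSet : Set UnitAddCircle := ⋃ n : ℤ, (fun τ => τ + ((n * θ : ℝ) : UnitAddCircle)) ⁻¹'
  {τ | ∃ᶠ j in atTop, τ ∈ slitNeighbourhood θ α k l j}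

variable {θ α k l}

lemma floorCount_eq_zero_of_notMem {j : ℕ} {x : ℝ}
    (h : (x : UnitAddCircle) ∉ slitNeighbourhood θ α k l j) :
    floorCount (slitOffset θ α k l j) x = 0 ∧
      transferStep θ (slitOffset θ α k l j) (k j - l j * θ) (l j) x = 0 := by
  constructor
  · by_contra h0
    refine h (Or.inl ?_)
    rw [mem_closedBall_zero_iff]
    exact norm_coe_le_of_floorCount_ne_zero h0
  · refine Finset.sum_eq_zero fun s hs => ?_
    by_contra h0
    refine h (Or.inr (Set.mem_biUnion hs ?_))
    have := norm_coe_le_of_floorCount_ne_zero h0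
    rw [Metric.mem_closedBall, dist_eq_norm, ← AddCircle.coe_sub]
    refine le_trans (le_of_eq ?_) this
    congr 2
    ring

lemma measurableSet_slitNeighbourhood (j : ℕ) : MeasurableSet (slitNeighbourhood θ α k l j) :=
  measurableSet_closedBall.union
    (Finset.measurableSet_biUnion _ fun _ _ => measurableSet_closedBall)

lemma volume_slitNeighbourhood_le (j : ℕ) : volume (slitNeighbourhood θ α k l j) ≤
    ENNReal.ofReal (2 * |slitOffset θ α k l j| + 2 * (l j * |k j - l j * θ|)) := by
  have hball : ∀ (τ : UnitAddCircle) (ε : ℝ),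
      volume (Metric.closedBall τ ε) ≤ ENNReal.ofReal (2 * ε) := fun τ ε => by
    rw [AddCircle.volume_closedBall]
    exact ENNReal.ofReal_le_ofReal (min_le_right _ _)
  rw [ENNReal.ofReal_add (by positivity) (by positivity)]
  refine (measure_union_le _ _).trans (add_le_add (hball _ _) ?_)
  refine (measure_biUnion_finset_le _ _).trans ((Finset.sum_le_sum fun s _ => hball _ _).trans ?_)
  rw [Finset.sum_const, Finset.card_range, nsmul_eq_mul, ← ENNReal.ofReal_natCast,
    ← ENNReal.ofReal_mul (by positivity)]
  exact ENNReal.ofReal_le_ofReal (le_of_eq (by ring))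

lemma measurableSet_badSet : MeasurableSet (badSet θ α k l) :=
  MeasurableSet.iUnion fun _ => (measurable_add_const _)
    (measurableSet_frequently_atTop fun j => measurableSet_slitNeighbourhood j)

lemma volume_badSet (h1 : Summable fun j => |slitOffset θ α k l j|)
    (h2 : Summable fun j => l j * |k j - l j * θ|) : volume (badSet θ α k l) = 0 := by
  refine measure_iUnion_null fun n => ?_
  rw [measure_preimage_add_right]
  refine measure_setOfPred_frequently_eq_zero (ne_top_of_le_ne_top
    ((h1.mul_left 2).add (h2.mul_left 2)).tsum_ofReal_ne_top
    (ENNReal.tsum_le_tsum fun j => volume_slitNeighbourhood_le j))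

lemma add_mem_badSet {τ : UnitAddCircle} :
    τ + (θ : UnitAddCircle) ∈ badSet θ α k l ↔ τ ∈ badSet θ α k l := by
  simp only [badSet, Set.mem_iUnion, Set.mem_preimage]
  constructor
  · rintro ⟨n, hn⟩
    refine ⟨n + 1, ?_⟩
    rwa [add_assoc, ← AddCircle.coe_add, ← show ((n + 1 : ℤ) : ℝ) * θ = θ + n * θ by
      push_cast; ring] at hn
  · rintro ⟨n, hn⟩
    refine ⟨n - 1, ?_⟩
    rwa [add_assoc, ← AddCircle.coe_add, show θ + ((n - 1 : ℤ) : ℝ) * θ = n * θ by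
      push_cast; ring]

lemma eventually_notMem_of_notMem_badSet {τ : UnitAddCircle} (h : τ ∉ badSet θ α k l) :
    ∀ᶠ j in atTop, τ ∉ slitNeighbourhood θ α k l j := by
  rw [← not_frequently]
  intro h'
  refine h (Set.mem_iUnion.2 ⟨0, ?_⟩)
  rw [Set.mem_preimage]
  simpa using h'

variable (θ α k l) in
/-- The points outside the bad set where the limit of the transfer functions is even (if `p` holds),
or odd (if `p` does not hold). -/
def transferSet (p : Prop) : Set ℝ :=
  {x | (x : UnitAddCircle) ∉ badSet θ α k l ∧ ∀ᶠ j in atTop, (Even (transferSum θ α k l j x) ↔ p)}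

lemma measurableSet_transferSet (p : Prop) : MeasurableSet (transferSet θ α k l p) := by
  refine MeasurableSet.inter ?_ (measurableSet_eventually_atTop
    (s := fun j => {x | Even (transferSum θ α k l j x) ↔ p}) fun j => ?_)
  · exact (AddCircle.measurable_mk' measurableSet_badSet).compl
  · have hm : Measurable (transferSum θ α k l j) := by
      unfold transferSum transferStep
      refine Finset.measurable_fun_sum _ fun i _ => Finset.measurable_fun_sum _ fun s _ => ?_
      exact (measurable_floorCount _).comp (by fun_prop)
    exact hm (MeasurableSet.of_discrete (s := {n : ℤ | Even n ↔ p}))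

lemma transferSet_disjoint : Disjoint (transferSet θ α k l True) (transferSet θ α k l False) := by
  rw [Set.disjoint_left]
  rintro x ⟨-, h1⟩ ⟨-, h2⟩
  obtain ⟨j, hj1, hj2⟩ := (h1.and h2).exists
  exact hj2.1 (hj1.2 trivial)

lemma mem_transferSet_true_or_false {x : ℝ} (hx : (x : UnitAddCircle) ∉ badSet θ α k l) :
    x ∈ transferSet θ α k l True ∨ x ∈ transferSet θ α k l False := by
  obtain ⟨J, hJ⟩ := eventually_atTop.1 (eventually_notMem_of_notMem_badSet hx)
  have hconst : ∀ j, J ≤ j → transferSum θ α k l j x = transferSum θ α k l J x := by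
    intro j hj
    induction j, hj using Nat.le_induction with
    | base => rfl
    | succ j hj ih =>
      rw [← ih, transferSum, Finset.sum_range_succ, (floorCount_eq_zero_of_notMem (hJ j hj)).2,
        add_zero]
      rfl
  by_cases h : Even (transferSum θ α k l J x)
  · exact Or.inl ⟨hx, eventually_atTop.2 ⟨J, fun j hj => by rw [hconst j hj]; simp [h]⟩⟩
  · exact Or.inr ⟨hx, eventually_atTop.2 ⟨J, fun j hj => by rw [hconst j hj]; simp [h]⟩⟩

lemma transferSet_add_intCast (p : Prop) (x : ℝ) (m : ℤ) :
    x + m ∈ transferSet θ α k l p ↔ x ∈ transferSet θ α k l p := by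
  have h1 : ((x + m : ℝ) : UnitAddCircle) = x := by
    rw [AddCircle.coe_add, add_eq_left]
    exact (AddCircle.coe_eq_zero_iff 1).2 ⟨m, by simp⟩
  have h2 : ∀ j, transferSum θ α k l j (x + m) = transferSum θ α k l j x := by
    intro j
    refine Finset.sum_congr rfl fun i _ => Finset.sum_congr rfl fun s _ => ?_
    rw [add_sub_right_comm, add_right_comm, floorCount_add_intCast]
  simp only [transferSet, Set.mem_ofPred_eq, h1, h2]

/-- In the limit the cocycle of the original slit is the coboundary of the transfer function. -/
lemma transferSet_sub (p : Prop) (x : ℝ) : x - θ ∈ transferSet θ α k l p ↔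
    x ∈ transferSet θ α k l (Even (floorCount α x) ↔ p) := by
  have h1 : ((x - θ : ℝ) : UnitAddCircle) ∈ badSet θ α k l ↔
      (x : UnitAddCircle) ∈ badSet θ α k l := by
    rw [← add_mem_badSet, ← AddCircle.coe_add, sub_add_cancel]
  simp only [transferSet, Set.mem_ofPred_eq, h1]
  refine and_congr_right fun hx => eventually_congr ?_
  filter_upwards [eventually_notMem_of_notMem_badSet hx] with j hj
  have h2 := even_floorCount_transferSum θ α k l j x
  rw [(floorCount_eq_zero_of_notMem hj).1, sub_zero, Int.even_add, Int.even_sub] at h2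
  tauto

end Transfer

/-! ### The invariant set -/

lemma exists_abs_le_half_cos (x : ℝ) : ∃ (y : ℝ) (m : ℤ), x = y + m ∧ |y| ≤ 1 / 2 ∧
    Real.cos (2 * Real.pi * x) = Real.cos (2 * Real.pi * |y|) := by
  refine ⟨x - round x, round x, by ring, abs_sub_round x, ?_⟩
  rw [← abs_of_pos Real.two_pi_pos, ← abs_mul, abs_of_pos Real.two_pi_pos, Real.cos_abs,
    ← Real.cos_sub_int_mul_two_pi _ (round x)]
  congr 1
  ring

/-- On the real axis, away from the slit the cocycle vanishes. -/
lemma floorCount_of_cos_lt {a : ℝ} (ha : a ∈ Set.Ioo (0 : ℝ) (1 / 2)) {x : ℝ}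
    (h : Real.cos (2 * Real.pi * x) < Real.cos (2 * Real.pi * a)) :
    floorCount (2 * a) (x + a) = 0 := by
  obtain ⟨y, m, rfl, hy, hcos⟩ := exists_abs_le_half_cos x
  rw [hcos] at h
  have hay : a < |y| := by
    by_contra h'
    rcases (not_lt.1 h').eq_or_lt with h' | h'
    · rw [h'] at h
      exact h.false
    · exact h.not_gt (Real.cos_two_pi_mul_lt (abs_nonneg y) h' ha.2.le)
  rw [add_right_comm, floorCount_add_intCast, floorCount, show y + a - 2 * a = y - a by ring,
    sub_eq_zero]
  have ha1 := ha.1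
  have ha2 := ha.2
  rcases le_total 0 y with h0 | h0
  · rw [abs_of_nonneg h0] at hay hy
    rw [(Int.floor_eq_iff.2 ⟨by push_cast; linarith, by push_cast; linarith⟩ : ⌊y + a⌋ = 0),
      (Int.floor_eq_iff.2 ⟨by push_cast; linarith, by push_cast; linarith⟩ : ⌊y - a⌋ = 0)]
  · rw [abs_of_nonpos h0] at hay hy
    rw [(Int.floor_eq_iff.2 ⟨by push_cast; linarith, by push_cast; linarith⟩ : ⌊y + a⌋ = -1),
      (Int.floor_eq_iff.2 ⟨by push_cast; linarith, by push_cast; linarith⟩ : ⌊y - a⌋ = -1)]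

/-- On the real axis, on the open slit the cocycle is `1`. -/
lemma floorCount_of_lt_cos {a : ℝ} (ha : a ∈ Set.Ioo (0 : ℝ) (1 / 2)) {x : ℝ}
    (h : Real.cos (2 * Real.pi * a) < Real.cos (2 * Real.pi * x)) :
    floorCount (2 * a) (x + a) = 1 := by
  obtain ⟨y, m, rfl, hy, hcos⟩ := exists_abs_le_half_cos x
  rw [hcos] at h
  have hay : |y| < a := by
    by_contra h'
    rcases (not_lt.1 h').eq_or_lt with h' | h'
    · rw [h'] at h
      exact h.false
    · exact h.not_gt (Real.cos_two_pi_mul_lt ha.1.le h' hy)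
  rw [add_right_comm, floorCount_add_intCast, floorCount, show y + a - 2 * a = y - a by ring]
  have ha1 := ha.1
  have ha2 := ha.2
  rw [abs_lt] at hay
  rw [(Int.floor_eq_iff.2 ⟨by push_cast; linarith, by push_cast; linarith⟩ : ⌊y + a⌋ = 0),
    (Int.floor_eq_iff.2 ⟨by push_cast; linarith, by push_cast; linarith⟩ : ⌊y - a⌋ = -1)]
  norm_num

namespace SlitTorus

variable {a : ℝ}

instance : MeasurableSpace (SlitTorus a) := borel _

instance : BorelSpace (SlitTorus a) := ⟨rfl⟩

/-- The sheet `Re Y > 0`. Over the open slit, where `Re Y = 0`, the sheet is the one that is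
reached immediately above the slit: there `Im F = sin 2πy` is positive, so that `Re Y` has the
sign of `Im Y`. -/
def OnUpperSheet (s : SlitTorus a) : Prop := 0 < s.root.re ∨ (s.root.re = 0 ∧ 0 < s.root.im)

/-- The horizontal coordinate of the point at height `0` that is reached from `s` by moving
downwards in the direction `(θ, 1)`, shifted by `a` so that the slit becomes the interval
`[0, 2a]`. The representatives of the coordinates of `s` are taken in `[0, 1)`. -/
def baseCoord (θ : ℝ) (s : SlitTorus a) : ℝ :=
  (AddCircle.equivIco 1 0 s.proj.1 : ℝ) - θ * (AddCircle.equivIco 1 0 s.proj.2 : ℝ) + a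

variable (a) in
/-- The points on the upper sheet whose base point has even limit transfer function, and the points
on the lower sheet whose base point has odd limit transfer function. -/
def invariantSet (θ : ℝ) (k : ℕ → ℤ) (l : ℕ → ℕ) : Set (SlitTorus a) :=
  {s | baseCoord θ s ∈ transferSet θ (2 * a) k l (OnUpperSheet s)}

variable {θ : ℝ} {k : ℕ → ℤ} {l : ℕ → ℕ}

/-- Membership in the invariant set in terms of a lift `z` to the plane with height in
`[n, n + 1)`. -/
lemma mem_invariantSet_iff {s : SlitTorus a} {z : ℂ} {n : ℤ} (hz : toTorus z = s.proj)
    (h1 : (n : ℝ) ≤ z.im) (h2 : z.im < n + 1) : s ∈ invariantSet a θ k l ↔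
      z.re - θ * (z.im - n) + a ∈ transferSet θ (2 * a) k l (OnUpperSheet s) := by
  have hn : ⌊z.im⌋ = n := Int.floor_eq_iff.2 ⟨h1, h2⟩
  have hb : z.re - θ * (z.im - n) + a = baseCoord θ s + (⌊z.re⌋ : ℤ) := by
    rw [baseCoord, ← hz, toTorus_apply, AddCircle.coe_equivIco_mk_apply,
      AddCircle.coe_equivIco_mk_apply, div_one, div_one, mul_one, mul_one, Int.fract, Int.fract, hn]
    ring
  rw [hb, transferSet_add_intCast]
  rfl

lemma measurableSet_invariantSet : MeasurableSet (invariantSet a θ k l) := by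
  have hroot : Measurable (root : SlitTorus a → ℂ) := continuous_root.measurable
  have hsheet : MeasurableSet {s : SlitTorus a | OnUpperSheet s} := by
    refine MeasurableSet.union ?_ (MeasurableSet.inter ?_ ?_)
    · exact (Complex.measurable_re.comp hroot) measurableSet_Ioi
    · exact (Complex.measurable_re.comp hroot) (measurableSet_singleton 0)
    · exact (Complex.measurable_im.comp hroot) measurableSet_Ioi
  have hx : Measurable fun τ : UnitAddCircle => (AddCircle.equivIco 1 0 τ : ℝ) :=
    measurable_subtype_coe.comp (AddCircle.measurableEquivIco 1 0).measurable
  have hproj1 : Measurable fun s : SlitTorus a => s.proj.1 :=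
    (continuous_fst.comp continuous_proj).measurable
  have hproj2 : Measurable fun s : SlitTorus a => s.proj.2 :=
    (continuous_snd.comp continuous_proj).measurable
  have hbase : Measurable (baseCoord θ : SlitTorus a → ℝ) :=
    ((hx.comp hproj1).sub ((hx.comp hproj2).const_mul θ)).add_const a
  have hset : invariantSet a θ k l = ({s | OnUpperSheet s} ∩
      baseCoord θ ⁻¹' transferSet θ (2 * a) k l True) ∪ ({s | OnUpperSheet s}ᶜ ∩
      baseCoord θ ⁻¹' transferSet θ (2 * a) k l False) := by
    ext s
    by_cases h : OnUpperSheet s <;> simp [invariantSet, h]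
  rw [hset]
  exact (hsheet.inter (hbase (measurableSet_transferSet _))).union
    (hsheet.compl.inter (hbase (measurableSet_transferSet _)))

lemma onUpperSheet_iff_of_re_ne_zero {s : SlitTorus a} (h : s.root.re ≠ 0) :
    OnUpperSheet s ↔ 0 < s.root.re := by
  simp [OnUpperSheet, h]

lemma onUpperSheet_iff_of_re_eq_zero {s : SlitTorus a} (h : s.root.re = 0) :
    OnUpperSheet s ↔ 0 < s.root.im := by
  simp [OnUpperSheet, h]

lemma root_re_im {s : SlitTorus a} {z : ℂ} (hz : toTorus z = s.proj) :
    2 * (s.root.re * s.root.im) = Real.sin (2 * Real.pi * z.im) := by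
  rw [← slitFun_toTorus_im a, hz, ← root_sq, sq, Complex.mul_im]
  ring

lemma root_re_sq_sub {s : SlitTorus a} {z : ℂ} (hz : toTorus z = s.proj) :
    s.root.re ^ 2 - s.root.im ^ 2 = Real.cos (2 * Real.pi * a) - Real.cos (2 * Real.pi * z.re) +
      (1 - Real.cos (2 * Real.pi * z.im)) := by
  rw [← slitFun_toTorus_re, hz, ← root_sq, sq s.root, Complex.mul_re]
  ring

lemma eventually_pos_iff {X : Type*} {F : Filter X} {f : X → ℝ} {c : ℝ} (hf : Tendsto f F (𝓝 c))
    (hc : c ≠ 0) : ∀ᶠ x in F, f x ≠ 0 ∧ (0 < f x ↔ 0 < c) := by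
  rcases lt_or_gt_of_ne hc with h | h
  · filter_upwards [hf.eventually (gt_mem_nhds h)] with x hx
    exact ⟨hx.ne, by simp [hx.not_gt, h.not_gt]⟩
  · filter_upwards [hf.eventually (lt_mem_nhds h)] with x hx
    exact ⟨hx.ne', by simp [hx, h]⟩

/-- `Re Y = 0` only over the slit. -/
lemma exists_int_of_re_eq_zero (ha : a ∈ Set.Ioo (0 : ℝ) (1 / 2)) {s : SlitTorus a} {z : ℂ}
    (hz : toTorus z = s.proj) (hre : s.root.re = 0) (h0 : s.root ≠ 0) :
    (∃ n : ℤ, z.im = n) ∧ Real.cos (2 * Real.pi * a) < Real.cos (2 * Real.pi * z.re) := by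
  have him : s.root.im ≠ 0 := fun him => h0 (Complex.ext hre him)
  have h1 := root_re_im hz
  have h2 := root_re_sq_sub hz
  rw [hre] at h1 h2
  rw [zero_mul, mul_zero] at h1
  have him2 : 0 < s.root.im ^ 2 := by positivity
  have hcos : -1 < Real.cos (2 * Real.pi * a) := by
    have := Real.cos_two_pi_mul_lt ha.1.le ha.2 le_rfl
    rwa [show 2 * Real.pi * (1 / 2) = Real.pi by ring, Real.cos_pi] at this
  have h3 := Real.cos_le_one (2 * Real.pi * z.re)
  have h4 : Real.cos (2 * Real.pi * z.im) = 1 := by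
    rcases Real.sin_eq_zero_iff_cos_eq.1 h1.symm with h | h
    · exact h
    · rw [h] at h2
      linarith
  rw [h4] at h2
  refine ⟨?_, by linarith⟩
  obtain ⟨n, hn⟩ := (Real.cos_eq_one_iff _).1 h4
  refine ⟨n, ?_⟩
  have := Real.pi_pos
  field_simp at hn
  exact hn.symm

/-- Membership in the invariant set is locally constant along the flow in the direction `(θ, 1)`.
This is clear unless the path reaches the real axis, where the base point moves by `θ`. There the
sheet changes on the slit, and only there, and this is compensated by the change of parity in
`transferSet_sub`. -/
lemma eventually_mem_invariantSet_iff (ha : a ∈ Set.Ioo (0 : ℝ) (1 / 2)) {γ : ℝ → SlitTorus a}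
    {J : Set ℝ} {s : ℝ} (hγ : ContinuousWithinAt γ J s) (h0 : (γ s).root ≠ 0)
    (hproj : ∀ u ∈ J, (γ u).proj = (γ s).proj + toTorus ⟨(u - s) * θ, u - s⟩) :
    ∀ᶠ u in 𝓝[J] s, (γ s ∈ invariantSet a θ k l ↔ γ u ∈ invariantSet a θ k l) := by
  obtain ⟨z, hz⟩ := toTorus_surjective (γ s).proj
  have hzu : ∀ u ∈ J, toTorus (z + ⟨(u - s) * θ, u - s⟩) = (γ u).proj := fun u hu => by
    rw [map_add, hz, hproj u hu]
  have hroot : Tendsto (fun u => (γ u).root) (𝓝[J] s) (𝓝 (γ s).root) :=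
    (continuous_root.tendsto _).comp hγ
  have hre : Tendsto (fun u => (γ u).root.re) (𝓝[J] s) (𝓝 (γ s).root.re) :=
    (Complex.continuous_re.tendsto _).comp hroot
  have him : Tendsto (fun u => (γ u).root.im) (𝓝[J] s) (𝓝 (γ s).root.im) :=
    (Complex.continuous_im.tendsto _).comp hroot
  have hnear : ∀ ε > 0, ∀ᶠ u in 𝓝[J] s, |u - s| < ε := fun ε hε =>
    mem_nhdsWithin_of_mem_nhds (Metric.ball_mem_nhds s hε)
  -- as long as the height does not cross an integer, the base coordinate is constant
  have hsame : ∀ n : ℤ, (n : ℝ) ≤ z.im → z.im < n + 1 → ∀ u ∈ J, (n : ℝ) ≤ z.im + (u - s) →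
      z.im + (u - s) < n + 1 → (OnUpperSheet (γ u) ↔ OnUpperSheet (γ s)) →
      (γ s ∈ invariantSet a θ k l ↔ γ u ∈ invariantSet a θ k l) := by
    intro n h1 h2 u hu h3 h4 h5
    rw [mem_invariantSet_iff hz h1 h2, mem_invariantSet_iff (hzu u hu) (n := n) h3 h4,
      iff_iff_eq.1 h5]
    simp only [Complex.add_re, Complex.add_im]
    refine iff_of_eq (congrArg (· ∈ _) ?_)
    ring
  -- an integer height is reached from below
  have hcross : ∀ n : ℤ, z.im = n → ∀ u ∈ J, -1 ≤ u - s → u - s < 0 →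
      (γ u ∈ invariantSet a θ k l ↔ z.re + a ∈
        transferSet θ (2 * a) k l (Even (floorCount (2 * a) (z.re + a)) ↔ OnUpperSheet (γ u))) := by
    intro n hn u hu h1 h2
    rw [mem_invariantSet_iff (hzu u hu) (n := n - 1), ← transferSet_sub]
    · simp only [Complex.add_re, Complex.add_im]
      refine iff_of_eq (congrArg (· ∈ _) ?_)
      rw [hn]
      push_cast
      ring
    · simp only [Complex.add_im, hn]
      push_cast
      linarith
    · simp only [Complex.add_im, hn]
      push_cast
      linarith
  have hself : ∀ n : ℤ, z.im = n → (γ s ∈ invariantSet a θ k l ↔ z.re + a ∈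
      transferSet θ (2 * a) k l (OnUpperSheet (γ s))) := by
    intro n hn
    rw [mem_invariantSet_iff hz (n := n) (by rw [hn]) (by rw [hn]; linarith), hn, sub_self,
      mul_zero, sub_zero]
  -- on the open slit the sheet before the crossing is opposite to the one after it
  by_cases hre0 : (γ s).root.re = 0
  · have him0 : (γ s).root.im ≠ 0 := fun him => h0 (Complex.ext hre0 him)
    obtain ⟨⟨n, hn⟩, hlt⟩ := exists_int_of_re_eq_zero ha hz hre0 h0
    have hodd := floorCount_of_lt_cos ha hlt
    filter_upwards [self_mem_nhdsWithin, hnear (1 / 2) (by norm_num),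
      eventually_pos_iff him him0] with u hu hus ⟨h1, h2⟩
    rw [abs_lt] at hus
    rcases lt_trichotomy (u - s) 0 with h | h | h
    · have hsin : (γ u).root.re * (γ u).root.im < 0 := by
        have h3 := root_re_im (hzu u hu)
        have h4 := Real.sin_two_pi_mul_neg h (by linarith)
        rw [Complex.add_im, hn, mul_add, add_comm, mul_comm (2 * Real.pi) (n : ℝ),
          Real.sin_add_int_mul_two_pi] at h3
        linarith
      have hre1 : (γ u).root.re ≠ 0 := fun h3 => by
        rw [h3, zero_mul] at hsin
        exact hsin.false
      have hsheet : OnUpperSheet (γ u) ↔ ¬ OnUpperSheet (γ s) := by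
        rw [onUpperSheet_iff_of_re_ne_zero hre1, onUpperSheet_iff_of_re_eq_zero hre0, ← h2]
        constructor
        · intro h3 h4
          exact hsin.not_gt (mul_pos h3 h4)
        · intro h3
          exact pos_of_mul_neg_left hsin (not_lt.1 h3)
      rw [hself n hn, hcross n hn u hu (by linarith) h, hodd, iff_iff_eq.1 hsheet]
      simp
    · rw [sub_eq_zero.1 h]
    · have hsin : 0 < (γ u).root.re * (γ u).root.im := by
        have h3 := root_re_im (hzu u hu)
        have h4 := Real.sin_two_pi_mul_pos h (by linarith)
        rw [Complex.add_im, hn, mul_add, add_comm, mul_comm (2 * Real.pi) (n : ℝ),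
          Real.sin_add_int_mul_two_pi] at h3
        linarith
      have hre1 : (γ u).root.re ≠ 0 := fun h3 => by
        rw [h3, zero_mul] at hsin
        exact hsin.false
      refine hsame n hn.ge (by rw [hn]; linarith) u hu (by linarith) (by linarith) ?_
      rw [onUpperSheet_iff_of_re_ne_zero hre1, onUpperSheet_iff_of_re_eq_zero hre0, ← h2]
      exact ⟨fun h3 => (pos_iff_pos_of_mul_pos hsin).1 h3,
        fun h3 => (pos_iff_pos_of_mul_pos hsin).2 h3⟩
  · have hsheet : ∀ᶠ u in 𝓝[J] s, (OnUpperSheet (γ u) ↔ OnUpperSheet (γ s)) := by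
      filter_upwards [eventually_pos_iff hre hre0] with u ⟨h1, h2⟩
      rw [onUpperSheet_iff_of_re_ne_zero h1, onUpperSheet_iff_of_re_ne_zero hre0, h2]
    by_cases hint : ∃ n : ℤ, z.im = n
    · obtain ⟨n, hn⟩ := hint
      have heven : floorCount (2 * a) (z.re + a) = 0 := by
        refine floorCount_of_cos_lt ha ?_
        have h1 := root_re_im hz
        have h2 := root_re_sq_sub hz
        rw [hn, mul_comm (2 * Real.pi) (n : ℝ)] at h1 h2
        rw [Real.cos_int_mul_two_pi] at h2
        have h3 : Real.sin (n * (2 * Real.pi)) = 0 := by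
          simpa using Real.sin_add_int_mul_two_pi 0 n
        rw [h3] at h1
        have h4 : (γ s).root.im = 0 := by
          rcases mul_eq_zero.1 (mul_eq_zero.1 h1 |>.resolve_left two_ne_zero) with h | h
          · exact absurd h hre0
          · exact h
        rw [h4] at h2
        have : 0 < (γ s).root.re ^ 2 := by positivity
        linarith
      filter_upwards [self_mem_nhdsWithin, hnear (1 / 2) (by norm_num), hsheet] with u hu hus hsh
      rw [abs_lt] at hus
      rcases lt_or_ge (u - s) 0 with h | h
      · rw [hself n hn, hcross n hn u hu (by linarith) h, heven, iff_iff_eq.1 hsh]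
        simp
      · exact hsame n hn.ge (by rw [hn]; linarith) u hu (by linarith) (by linarith) hsh
    · have hlt : (⌊z.im⌋ : ℝ) < z.im :=
        lt_of_le_of_ne (Int.floor_le _) fun h => hint ⟨_, h.symm⟩
      have hlt' := Int.lt_floor_add_one z.im
      filter_upwards [self_mem_nhdsWithin, hnear _ (sub_pos.2 hlt), hnear _ (sub_pos.2 hlt'),
        hsheet] with u hu h1 h2 hsh
      rw [abs_lt] at h1 h2
      exact hsame ⌊z.im⌋ hlt.le hlt' u hu (by linarith) (by linarith) hsh

lemma shearFlow_symm_I (θ : ℝ) : (shearFlow θ 0).symm Complex.I = ⟨θ, 1⟩ := by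
  rw [ContinuousLinearEquiv.symm_apply_eq, shearFlow_apply]
  apply Complex.ext <;> simp

lemma isVerticallySaturated_invariantSet (ha : a ∈ Set.Ioo (0 : ℝ) (1 / 2)) :
    (surface ha θ 0).IsVerticallySaturated (invariantSet a θ k l) := by
  rintro x y ⟨γ, T, hT, rfl, rfl, hst⟩
  change ℝ → SlitTorus a at γ
  refine isPreconnected_Icc.induction₂ (s := Set.Icc 0 T)
    (fun s u => γ s ∈ invariantSet a θ k l ↔ γ u ∈ invariantSet a θ k l)
    (fun s hs => eventually_mem_invariantSet_iff ha (continuousOn_of_isStraightOn hst s hs)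
      (root_ne_zero_of_isStraightOn hst hs) fun u hu => ?_)
    (fun _ _ _ _ _ _ h1 h2 => h1.trans h2) (fun _ _ _ _ h => h.symm)
    (Set.left_mem_Icc.2 hT) (Set.right_mem_Icc.2 hT)
  rw [proj_of_isStraightOn hst isPreconnected_Icc hs hu, shearFlow_symm_I]
  congr 2
  apply Complex.ext <;> simp

end SlitTorus

/-! ### Failure of ergodicity -/

lemma Complex.preimage_re_null {s : Set ℝ} (hs : volume s = 0) : volume (Complex.re ⁻¹' s) = 0 :=
  (Measure.quasiMeasurePreserving_fst.comp
    Complex.volume_preserving_equiv_real_prod.quasiMeasurePreserving).preimage_null hs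

namespace SlitTorus

variable {a : ℝ} {θ t : ℝ}

/-- A coordinate on the regular part that lifts the projection to the torus becomes a natural
parameter after composition with `shearFlow θ t`. -/
lemma isNaturalParameter_of_toTorus (ha : a ∈ Set.Ioo (0 : ℝ) (1 / 2))
    {ψ : OpenPartialHomeomorph (SlitTorus a) ℂ} (h1 : ∀ x ∈ ψ.source, toTorus (ψ x) = x.proj)
    (h2 : ∀ x ∈ ψ.source, x.root ≠ 0) : (surface ha θ t).IsNaturalParameter
      (ψ.transHomeomorph (shearFlow θ t).toHomeomorph) := by
  refine (isNaturalParameter_surface_iff (ha := ha)).2 fun x hx => ⟨h2 x hx, ?_⟩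
  obtain ⟨τ, hτ⟩ := toTorus_dev ha x
  have hx' : x ∈ ψ.source := hx
  refine ⟨shearFlow θ t (ψ x - (coneAtlas ha).dev x x), ?_⟩
  filter_upwards [eventually_eq_add_of_toTorus (τ := -τ) (ψ.continuousAt hx')
    (continuousAt_dev ha x) (by
      filter_upwards [hτ, ψ.open_source.mem_nhds hx'] with y hy hy'
      rw [hy, h1 y hy', add_neg_cancel_right])] with y hy
  rw [← map_add, ← hy]
  rfl

/-- Over the open unit square with lower side on the real axis the two sheets are separated: `F`
is not a nonpositive real number there. -/
lemma slitFun_toTorus_mem_slitPlane (ha : a ∈ Set.Ioo (0 : ℝ) (1 / 2)) {z : ℂ}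
    (hz : z ∈ (boxChart ⟨0, 1 / 2⟩).source) : slitFun a (toTorus z) ∈ Complex.slitPlane := by
  obtain ⟨-, hz⟩ := mem_boxChart_source.1 hz
  rw [abs_lt] at hz
  simp only at hz
  rw [Complex.mem_slitPlane_iff, slitFun_toTorus_re, slitFun_toTorus_im]
  rcases lt_trichotomy z.im (1 / 2) with h | h | h
  · exact Or.inr (Real.sin_two_pi_mul_pos (by linarith) h).ne'
  · left
    have hcos := Real.cos_two_pi_mul_lt ha.1.le ha.2 le_rfl
    have hpi : 2 * Real.pi * (1 / 2) = Real.pi := by ring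
    rw [hpi, Real.cos_pi] at hcos
    rw [h, hpi, Real.cos_pi]
    linarith [Real.cos_le_one (2 * Real.pi * z.re)]
  · right
    have h1 := Real.sin_two_pi_mul_neg (y := z.im - 1) (by linarith) (by linarith)
    rw [show 2 * Real.pi * (z.im - 1) = 2 * Real.pi * z.im - 2 * Real.pi by ring,
      Real.sin_sub_two_pi] at h1
    exact h1.ne

/-- The coordinate `z` on the part of the sheet `Y = ε √F` (with `ε = ±1`) over the open unit
square with lower side on the real axis. -/
def sheetChart (ha : a ∈ Set.Ioo (0 : ℝ) (1 / 2)) (ε : ℝ) (hε : ε ^ 2 = 1) :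
    OpenPartialHomeomorph (SlitTorus a) ℂ :=
  sectionChart ⟨0, 1 / 2⟩ (boxChart ⟨0, 1 / 2⟩).source (boxChart _).open_source subset_rfl
    (fun z => ε * (slitFun a (toTorus z)).sqrt)
    (continuousOn_const.mul fun z hz => ContinuousAt.comp_continuousWithinAt (g := Complex.sqrt)
      (f := fun z => slitFun a (toTorus z)) (Complex.continuousAt_sqrt
        ((Complex.mem_slitPlane_iff.1 (slitFun_toTorus_mem_slitPlane ha hz)).imp_left le_of_lt))
      (by fun_prop))
    (fun z _ => by
      rw [mul_pow, Complex.sqrt_sq, ← Complex.ofReal_pow, hε, Complex.ofReal_one, one_mul])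
    (fun z hz => mul_ne_zero (by
      rw [Complex.ofReal_ne_zero]
      rintro rfl
      norm_num at hε) (Complex.sqrt_ne_zero (Complex.slitPlane_ne_zero
        (slitFun_toTorus_mem_slitPlane ha hz))))

variable {k : ℕ → ℤ} {l : ℕ → ℕ}

lemma sheetChart_symm_mem_invariantSet (ha : a ∈ Set.Ioo (0 : ℝ) (1 / 2)) {ε : ℝ} (hε : ε ^ 2 = 1)
    {z : ℂ} (hz : z ∈ (boxChart ⟨0, 1 / 2⟩).source) :
    (sheetChart ha ε hε).symm z ∈ invariantSet a θ k l ↔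
      z.re - θ * z.im + a ∈ transferSet θ (2 * a) k l (0 < ε) := by
  set s : SlitTorus a := (sheetChart ha ε hε).symm z with hs
  have hp : s.proj = toTorus z := proj_mk' _ _
  have hr : s.root = ε * (slitFun a (toTorus z)).sqrt := root_mk' (by
    rw [mul_pow, Complex.sqrt_sq, ← Complex.ofReal_pow, hε, Complex.ofReal_one, one_mul])
  have hpos := Complex.re_sqrt_pos (slitFun_toTorus_mem_slitPlane ha hz)
  have hre : s.root.re = ε * (slitFun a (toTorus z)).sqrt.re := by
    rw [hr, Complex.re_ofReal_mul]
  have h0 : s.root.re ≠ 0 := by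
    rw [hre]
    refine mul_ne_zero ?_ hpos.ne'
    rintro rfl
    norm_num at hε
  have hsheet : OnUpperSheet s ↔ 0 < ε := by
    rw [onUpperSheet_iff_of_re_ne_zero h0, hre, mul_pos_iff_of_pos_right hpos]
  obtain ⟨-, hz2⟩ := mem_boxChart_source.1 hz
  rw [abs_lt] at hz2
  simp only at hz2
  rw [mem_invariantSet_iff (n := 0) hp.symm (by push_cast; linarith) (by push_cast; linarith),
    iff_iff_eq.1 hsheet, Int.cast_zero, sub_zero]

/-- In the natural parameters of the two sheets over an open unit square, the invariant set is the
set of points with even, respectively odd, limit transfer function. These two sets are disjoint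
and cover the square up to a null set, so that neither the invariant set nor its complement is
null. -/
lemma not_isVerticallyErgodic_surface (ha : a ∈ Set.Ioo (0 : ℝ) (1 / 2))
    (h1 : Summable fun j => |slitOffset θ (2 * a) k l j|)
    (h2 : Summable fun j => l j * |k j - l j * θ|) :
    ¬ (surface ha θ 0).IsVerticallyErgodic := by
  intro h
  set G := shearFlow θ 0 with hG
  set W : Set ℂ := G.symm ⁻¹' (boxChart ⟨0, 1 / 2⟩).source with hW
  have hGs : ∀ w : ℂ, (G.symm w).re - θ * (G.symm w).im = w.re := fun w => by
    have := congrArg Complex.re (G.apply_symm_apply w)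
    rw [hG, shearFlow_apply] at this
    simpa using this
  have hbad : volume {w : ℂ | ((w.re + a : ℝ) : UnitAddCircle) ∈ badSet θ (2 * a) k l} = 0 := by
    refine Complex.preimage_re_null
      (s := {x : ℝ | ((x + a : ℝ) : UnitAddCircle) ∈ badSet θ (2 * a) k l}) ?_
    exact (measure_preimage_add_right volume a _).trans
      (AddCircle.preimage_null (volume_badSet h1 h2))
  have hWpos : volume W ≠ 0 := by
    refine (((boxChart ⟨0, 1 / 2⟩).open_source.preimage G.symm.continuous).measure_pos volume
      ⟨G ⟨0, 1 / 2⟩, ?_⟩).ne'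
    rw [Set.mem_preimage, G.symm_apply_apply]
    exact boxChart_self _
  -- both sheets over the open square, read in the natural parameter
  have key : ∀ (ε : ℝ) (hε : ε ^ 2 = 1) (A : Set (SlitTorus a)), (surface ha θ 0).IsNull A →
      volume {w | w ∈ W ∧ (sheetChart ha ε hε).symm (G.symm w) ∈ A} = 0 := fun ε hε A hA =>
    hA _ (isNaturalParameter_of_toTorus (ψ := sheetChart ha ε hε) ha
      (fun x hx => toTorus_sectionChart hx) fun x hx => root_ne_zero_of_mem_sectionChart hx)
  have hmem : ∀ (ε : ℝ) (hε : ε ^ 2 = 1) (w : ℂ), w ∈ W →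
      ((sheetChart ha ε hε).symm (G.symm w) ∈ invariantSet a θ k l ↔
        w.re + a ∈ transferSet θ (2 * a) k l (0 < ε)) := fun ε hε w hw => by
    rw [sheetChart_symm_mem_invariantSet ha hε hw, hGs]
  have hpos : (0 < (1 : ℝ)) = True := by simp
  have hneg : (0 < (-1 : ℝ)) = False := by simp
  rcases h (invariantSet a θ k l) measurableSet_invariantSet
    (isVerticallySaturated_invariantSet ha) with hA | hA
  · refine hWpos (measure_mono_null ?_ (measure_union_null (measure_union_null
      (key 1 (by norm_num) _ hA) (key (-1) (by norm_num) _ hA)) hbad))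
    intro w hw
    by_cases hb : ((w.re + a : ℝ) : UnitAddCircle) ∈ badSet θ (2 * a) k l
    · exact Or.inr hb
    refine Or.inl ?_
    rcases mem_transferSet_true_or_false hb with h | h
    · exact Or.inl ⟨hw, (hmem 1 _ w hw).2 (by rwa [hpos])⟩
    · exact Or.inr ⟨hw, (hmem (-1) _ w hw).2 (by rwa [hneg])⟩
  · refine hWpos (measure_mono_null ?_ (measure_union_null
      (key 1 (by norm_num) _ hA) (key (-1) (by norm_num) _ hA)))
    intro w hw
    by_cases hw1 : w.re + a ∈ transferSet θ (2 * a) k l True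
    · refine Or.inr ⟨hw, fun h => Set.disjoint_left.1 transferSet_disjoint hw1 ?_⟩
      have := (hmem (-1) _ w hw).1 h
      rwa [hneg] at this
    · refine Or.inl ⟨hw, fun h => hw1 ?_⟩
      have := (hmem 1 _ w hw).1 h
      rwa [hpos] at this

end SlitTorus

end

/-! ### The surface with a slowly diverging Teichmüller geodesic -/

theorem theorem1p3 (r : ℝ → ℝ) (hr : Tendsto r atTop atTop) :
    ∃ X : ℝ → TranslationSurface, IsTeichmullerGeodesic X ∧ (X 0).zeros.Nonempty ∧
      ¬ (X 0).IsVerticallyErgodic ∧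
      liminf (fun t : ℝ => (X t).logSystole / ((r t : ℝ) : EReal)) atTop < 1 := by
  have h2lt : √2 < 2 := (Real.sqrt_lt' two_pos).2 (by norm_num)
  have ha : √2 / 4 ∈ Set.Ioo (0 : ℝ) (1 / 2) := ⟨by positivity, by linarith⟩
  have hα : Irrational (2 * (√2 / 4)) := by
    rw [show 2 * (√2 / 4) = √2 / (2 : ℕ) by push_cast; ring]
    exact irrational_sqrt_two.div_natCast two_ne_zero
  set D : ℕ → ℝ := fun j => -2 * Real.log ((1 / 4 : ℝ) ^ j / 2 / 2) with hD
  -- `D j` bounds `d` at the time `τ j = 2 log (l j)`, when no saddle connection is shorter than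
  -- `4 ^ (-j) / 4`; it does not depend on the choice of `l j`
  have hT : ∀ j, ∃ T : ℝ, ∀ t ≥ T, max (2 * D j) 1 ≤ r t := fun j =>
    eventually_atTop.1 (hr.eventually_ge_atTop _)
  choose T hT using hT
  obtain ⟨k, l, θ, hl, H⟩ := exists_slit_directions hα
    fun j => Real.exp (max (T j) j / 2)
  lift l to ℕ → ℕ using fun j => (hl j).le
  have hτ : ∀ j, 1 ≤ j → max (T j) j ≤ 2 * Real.log (l j : ℝ) := fun j hj => by
    have h := (H j hj).2.1
    have h' := Real.log_le_log (Real.exp_pos _) h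
    rw [Real.log_exp, Int.cast_natCast] at h'
    linarith
  have hpow : ∀ j : ℕ, 1 ≤ j → (1 / 4 : ℝ) ^ j ≤ 1 / 4 := fun j hj => by
    simpa using pow_le_pow_of_le_one (by norm_num : (0 : ℝ) ≤ 1 / 4) (by norm_num) hj
  have hgeo : Summable fun j : ℕ => (1 / 4 : ℝ) ^ (j + 1) :=
    (summable_nat_add_iff 1).2 (summable_geometric_of_lt_one (by norm_num) (by norm_num))
  refine ⟨SlitTorus.surface ha θ, SlitTorus.isTeichmullerGeodesic_surface ha θ,
    ⟨SlitTorus.conePoint _, SlitTorus.mem_zeros_surface.2 rfl⟩,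
    SlitTorus.not_isVerticallyErgodic_surface (k := k) (l := l) ha ?_ ?_, ?_⟩
  · refine (summable_nat_add_iff 1).1 (Summable.of_nonneg_of_le (fun _ => abs_nonneg _)
      (fun j => ?_) (hgeo.mul_left 4))
    simpa [slitOffset] using (H (j + 1) (by omega)).2.2.2.2.1
  · refine (summable_nat_add_iff 1).1 (Summable.of_nonneg_of_le (fun _ => by positivity)
      (fun j => ?_) (hgeo.mul_left 2))
    simpa using (H (j + 1) (by omega)).2.2.2.2.2
  · refine liminf_logSystole_div_lt_one (τ := fun j => 2 * Real.log (l j : ℝ)) (D := D) ?_ ?_ ?_ ?_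
    · refine tendsto_atTop_mono' _ ?_ tendsto_natCast_atTop_atTop
      filter_upwards [eventually_ge_atTop 1] with j hj using (le_max_right _ _).trans (hτ j hj)
    · filter_upwards [eventually_ge_atTop 1] with j hj
      exact one_pos.trans_le ((le_max_right _ _).trans
        (hT j _ ((le_max_left _ _).trans (hτ j hj))))
    · filter_upwards [eventually_ge_atTop 1] with j hj
      obtain ⟨h1, -, h3, h4, -, h6⟩ := H j hj
      have hj4 := hpow j hj
      refine TranslationSurface.logSystole_le (by positivity) fun γ v h =>
        SlitTorus.le_norm_of_isSaddleConnection (k := k j) (l := l j)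
          (m := 2 * ∑ i ∈ Finset.range j, k i) (n := 2 * ∑ i ∈ Finset.range j, (l i : ℤ)) (θ := θ)
          h1 (hl j) (by linarith) (by positivity) ?_ ?_ γ v (by exact_mod_cast h)
      · push_cast at h3 ⊢
        exact h3
      · push_cast at h4 ⊢
        exact h4.trans hj4
    · filter_upwards [eventually_ge_atTop 1] with j hj
      exact (le_max_left _ _).trans (hT j _ ((le_max_left _ _).trans (hτ j hj)))
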